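/- Let $\mathbb H^2=\{(\cosh r,(\sinh r)\gamma):\ r\ge 0,\ \gamma=(\cos\theta,\sin\theta)\in\mathbb S^1\}$ be the hyperbolic plane, with the metric $g=\mathrm dr^2+\sinh^2 r\,\mathrm d\theta^2$ induced by the Minkowski metric of $\mathbb R^{1+2}$. Let $X$ be the generator of the geodesic flow on $T\mathbb H^2$. For $f_0\in C^1(T\mathbb H^2)$, the corresponding Vlasov field is the $C^1$ solution $f=f(t,x,v)$ on $[0,\infty)\times T\mathbb H^2$ of $$\partial_t f+Xf=0,\qquad f(0,\cdot)=f_0,$$ and its spatial density is $\rho(f)(t,x)=\int_{T_x\mathbb H^2} f(t,x,v)\,\mathrm{dvol}_{T_x\mathbb H^2}(v)$. Write $\|f_0\|_{L^\infty}=\sup_{T\mathbb H^2}|f_0|$ and $\|f_0\|_{W^{1,\infty}}=\sup_{T\mathbb H^2}|f_0|+\sup_{T\mathbb H^2}|\mathrm df_0|$, where $|\mathrm df_0|$ is the norm with respect to the Sasaki metric of $T\mathbb H^2$. **Theorem (polynomial decay for Vlasov fields on hyperbolic space).** For every compact set $K\subset T\mathbb H^2$ there is a constant $C>0$, depending only on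 $K$, such that for every $f_0\in C^1(T\mathbb H^2)$ with support in $K$ (with no restriction near zero velocity) the corresponding Vlasov field $f$ exists, and any such $f$ satisfies the following for every $t\ge 1$: the integral defining $\rho(f)(t,x)$ converges absolutely for every $x\in\mathbb H^2$, $\rho(f)(t,\cdot)$ is differentiable on $\mathbb H^2$, and $$|\rho(f)(t,x)|\le \frac{C}{t^{2}}\,\|f_0\|_{L^\infty}\quad\text{for every }x\in\mathbb H^2,$$ $$\Big|\frac{1}{\sinh r}\,\partial_\theta\rho(f)(t,x)\Big|\le \frac{C}{t}\,\|f_0\|_{W^{1,\infty}},\qquad |\partial_r\rho(f)(t,x)|\le \frac{C}{t}\,\|f_0\|_{W^{1,\infty}}$$ for every $x\in\mathbb H^2$ with polar coordinates $(r,\theta)$, $r>0$; at the origin the second bound holds for the derivative along every unit-speed radial geodesic. -/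

import Mathlib

namespace H2

/-! Hyperbolic plane as the upper sheet of the hyperboloid in Minkowski space, described in its
global graph chart, which is a diffeomorphism from the plane onto the sheet. -/

/-- The coordinate plane. Also used for the components of tangent vectors in the global chart. -/
abbrev Chart : Type := EuclideanSpace ℝ (Fin 2)

/-- The tangent bundle in the induced global chart: pairs `(x, v)` stand for the tangent vector
`v^i ∂_{x^i}` at the point with coordinates `x`. -/
abbrev TH : Type := Chart × Chart

/-- The Lorentzian form `-dt ⊗ dt + dx¹ ⊗ dx¹ + dx² ⊗ dx²`. -/
noncomputable def minkowski (p q : ℝ × Chart) : ℝ := -(p.1 * q.1) + inner ℝ p.2 q.2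

/-- The upper sheet of the hyperboloid. -/
def hyperboloid : Set (ℝ × Chart) := {p | minkowski p p = -1 ∧ 0 < p.1}

/-- The global parametrization of the hyperboloid as a graph over the plane. -/
noncomputable def embed (x : Chart) : ℝ × Chart := (√(1 + ‖x‖ ^ 2), x)

theorem embed_injective : Function.Injective embed := fun _ _ h => congrArg Prod.snd h

theorem range_embed : Set.range embed = hyperboloid := by
  ext ⟨s, x⟩
  simp only [Set.mem_range, embed, hyperboloid, minkowski, Set.mem_ofPred_eq, Prod.mk.injEq,
    real_inner_self_eq_norm_sq]
  constructor
  · rintro ⟨y, rfl, rfl⟩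
    have h : 0 < 1 + ‖y‖ ^ 2 := by positivity
    refine ⟨?_, Real.sqrt_pos.2 h⟩
    rw [Real.mul_self_sqrt h.le]
    ring
  · rintro ⟨h, hs⟩
    refine ⟨x, ?_, rfl⟩
    rw [show 1 + ‖x‖ ^ 2 = s ^ 2 by linarith [pow_two s], Real.sqrt_sq hs.le]

/-- The point with polar coordinates `(r, θ)`. -/
noncomputable def polar (r θ : ℝ) : Chart :=
  !₂[Real.sinh r * Real.cos θ, Real.sinh r * Real.sin θ]

/-- `polar r θ` is the point `(cosh r, (sinh r) γ)` of the hyperboloid, `γ = (cos θ, sin θ)`. -/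
theorem embed_polar (r θ : ℝ) :
    embed (polar r θ) = (Real.cosh r, Real.sinh r • !₂[Real.cos θ, Real.sin θ]) := by
  refine Prod.ext ?_ ?_
  · simp only [embed, polar, EuclideanSpace.norm_sq_eq, Fin.sum_univ_two, Real.norm_eq_abs, sq_abs]
    have h : 1 + ((Real.sinh r * Real.cos θ) ^ 2 + (Real.sinh r * Real.sin θ) ^ 2)
        = Real.cosh r ^ 2 := by
      rw [Real.cosh_sq]
      linear_combination Real.sinh r ^ 2 * Real.sin_sq_add_cos_sq θ
    simp [h, Real.sqrt_sq (Real.cosh_pos r).le]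
  · ext i
    fin_cases i <;> simp [embed, polar]

/-- The Riemannian metric induced on the hyperboloid by the Minkowski form. -/
noncomputable def metric (x v w : Chart) : ℝ :=
  minkowski (fderiv ℝ embed x v) (fderiv ℝ embed x w)

/-- The coordinate vector `∂_{x^i}`. -/
noncomputable def basisVec (i : Fin 2) : Chart := EuclideanSpace.single i 1

/-- The matrix `g_{ij}` of the metric. -/
noncomputable def gram (x : Chart) : Matrix (Fin 2) (Fin 2) ℝ :=
  Matrix.of fun i j => metric x (basisVec i) (basisVec j)

/-- `∂_{x^m} g_{ij}`. -/
noncomputable def dgram (m i j : Fin 2) (x : Chart) : ℝ :=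
  fderiv ℝ (fun y => gram y i j) x (basisVec m)

/-- The Christoffel symbol `Γ^k_{ij}` of the Levi-Civita connection. -/
noncomputable def christoffel (k i j : Fin 2) (x : Chart) : ℝ :=
  (1 / 2) * ∑ l, (gram x)⁻¹ k l * (dgram i j l x + dgram j i l x - dgram l i j x)

/-- Horizontal lift `Y^i ∂_{x^i} - Y^i v^j Γ^k_{ij} ∂_{v^k}` at `z = (x, v)`. -/
noncomputable def hor (z : TH) (Y : Chart) : TH :=
  (Y, WithLp.toLp 2 fun k => -∑ i, ∑ j, Y i * z.2 j * christoffel k i j z.1)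

/-- Vertical lift `Y^i ∂_{v^i}`. -/
def ver (Y : Chart) : TH := (0, Y)

/-- The generator of the geodesic flow. -/
noncomputable def geodesicField (z : TH) : TH := hor z z.2

/-- `f` is the `C¹` solution on `[0, ∞) × TH²` of `∂_t f + X f = 0` with initial datum `f₀`. -/
structure IsVlasovField (f₀ : TH → ℝ) (f : ℝ → TH → ℝ) : Prop where
  contDiffOn : ContDiffOn ℝ 1 (fun p : ℝ × TH => f p.1 p.2) (Set.Ici 0 ×ˢ Set.univ)
  initial : f 0 = f₀
  equation : ∀ t : ℝ, 0 ≤ t → ∀ z : TH,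
    derivWithin (fun s => f s z) (Set.Ici 0) t + fderiv ℝ (f t) z (geodesicField z) = 0

/-- The spatial density `ρ(f)(t, x) = ∫ f(t, x, v) √(det g) dv¹ dv²`. -/
noncomputable def density (f : ℝ → TH → ℝ) (t : ℝ) (x : Chart) : ℝ :=
  ∫ v : Chart, f t (x, v) * √(gram x).det

/-- The sup norm; for continuous functions this is the `L^∞` norm. -/
noncomputable def supNorm (h : TH → ℝ) : ℝ := ⨆ z, |h z|

/-- The supremum of the norm of the differential of `h` with respect to the Sasaki metric, in which
`Hor(Y) + Ver(Z)` has squared length `g(Y, Y) + g(Z, Z)`. -/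
noncomputable def gradNorm (h : TH → ℝ) : ℝ :=
  sSup {a | ∃ (z : TH) (Y Z : Chart), metric z.1 Y Y + metric z.1 Z Z ≤ 1 ∧
    a = |fderiv ℝ h z (hor z Y + ver Z)|}

/-- The `W^{1,∞}` norm of a `C¹` function on the tangent bundle with its Sasaki metric. -/
noncomputable def sobolevNorm (h : TH → ℝ) : ℝ := supNorm h + gradNorm h

end H2

section

open Real Set Filter Topology MeasureTheory
open scoped RealInnerProductSpace

/-! In this chart the geodesic equation is `x'' = g(x', x') x`. Since the speed is conserved, the
flow is explicit, with coefficients `cosh (t|v|)` and `sinh (t|v|) / |v|`; these are smooth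
functions of `|v|²`, so zero velocity is not singular. A Vlasov field is constant along the flow
(`IsVlasovField.eq_flow`). For fixed `t` and `x`, replace the velocity `v` by the initial position
`y`, so that `v = -t⁻¹ log_x y`. The initial velocity is then `t⁻¹ log_y x`, and the Jacobian is
`t⁻² · arc e · height x / height y`, where `e = cosh d(x, y)` and `arc (cosh τ) = τ / sinh τ`
(`det_logMapDeriv`). Hence `ρ(t, x)` is `t⁻²` times the integral of `arc e / height y · f₀(y, t⁻¹
log_y x)` over the fixed compact projection of `K` (`IsVlasovField.integrable_and_density_eq`). The
integrand is bounded because `arc ≤ 2`. Its derivative in a unit direction is bounded too: the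
differential of `log_y` grows at most linearly in `|log_y x|` (`norm_logMapDeriv_le`), and on the
support of `f₀` this is `O(t)`, which the factor `t⁻¹` absorbs. Thus the derivatives also decay like
`t⁻²`. -/

namespace H2

/-! ### Metric, Christoffel symbols and speed in the graph chart. -/

/-- The time coordinate on the hyperboloid. -/
noncomputable def height (x : Chart) : ℝ := √(1 + ‖x‖ ^ 2)

theorem height_sq (x : Chart) : height x ^ 2 = 1 + ‖x‖ ^ 2 := Real.sq_sqrt (by positivity)

theorem height_pos (x : Chart) : 0 < height x := Real.sqrt_pos.2 (by positivity)

theorem one_le_height (x : Chart) : 1 ≤ height x := by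
  nlinarith [height_sq x, height_pos x, sq_nonneg ‖x‖]

theorem norm_le_height (x : Chart) : ‖x‖ ≤ height x :=
  abs_le_of_sq_le_sq' (by nlinarith [height_sq x]) (height_pos x).le |>.2

theorem contDiff_height {n : WithTop ℕ∞} : ContDiff ℝ n height := by
  unfold height
  exact (contDiff_const.add (contDiff_norm_sq ℝ)).sqrt fun x => by positivity

theorem hasFDerivAt_height (x : Chart) :
    HasFDerivAt height ((height x)⁻¹ • innerSL ℝ x) x := by
  have h1 : HasFDerivAt (fun x : Chart => 1 + ‖x‖ ^ 2) (2 • innerSL ℝ x) x :=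
    (hasStrictFDerivAt_norm_sq x).hasFDerivAt.const_add 1
  have h2 := h1.sqrt (by positivity)
  refine h2.congr_fderiv ?_
  ext v
  simp [height]
  ring

theorem fderiv_embed (x v : Chart) : fderiv ℝ embed x v = (⟪x, v⟫ / height x, v) := by
  have h : HasFDerivAt embed (((height x)⁻¹ • innerSL ℝ x).prod (ContinuousLinearMap.id ℝ Chart)) x :=
    (hasFDerivAt_height x).prodMk (hasFDerivAt_id x)
  rw [h.fderiv]
  simp
  ring

theorem metric_eq (x v w : Chart) :
    metric x v w = ⟪v, w⟫ - ⟪x, v⟫ * ⟪x, w⟫ / (1 + ‖x‖ ^ 2) := by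
  have := (height_pos x).ne'
  rw [metric, fderiv_embed, fderiv_embed, minkowski, ← height_sq]
  field_simp
  ring

theorem inner_basisVec (x : Chart) (i : Fin 2) : ⟪x, basisVec i⟫ = x i := by
  simp [basisVec, EuclideanSpace.inner_single_right]

theorem gram_eq (x : Chart) (i j : Fin 2) :
    gram x i j = (if i = j then 1 else 0) - x i * x j * (1 + ‖x‖ ^ 2)⁻¹ := by
  rw [gram, Matrix.of_apply, metric_eq, inner_basisVec, inner_basisVec, inner_basisVec]
  congr 1
  simp [basisVec, eq_comm]

theorem det_gram (x : Chart) : (gram x).det = (1 + ‖x‖ ^ 2)⁻¹ := by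
  have h : 1 + ‖x‖ ^ 2 = 1 + (x 0 ^ 2 + x 1 ^ 2) := by
    simp [EuclideanSpace.norm_sq_eq, Fin.sum_univ_two]
  have : 1 + (x 0 ^ 2 + x 1 ^ 2) ≠ 0 := by positivity
  rw [Matrix.det_fin_two]
  simp only [gram_eq, h]
  simp
  field_simp
  ring

theorem sqrt_det_gram (x : Chart) : √(gram x).det = (height x)⁻¹ := by
  rw [det_gram, Real.sqrt_inv, height]

theorem inv_gram (x : Chart) : (gram x)⁻¹ = Matrix.of fun i j => (if i = j then 1 else 0) + x i * x j := by
  apply Matrix.inv_eq_right_inv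
  have h : 1 + ‖x‖ ^ 2 = 1 + (x 0 ^ 2 + x 1 ^ 2) := by
    simp [EuclideanSpace.norm_sq_eq, Fin.sum_univ_two]
  have : 1 + (x 0 ^ 2 + x 1 ^ 2) ≠ 0 := by positivity
  ext i j
  rw [Matrix.mul_apply, Fin.sum_univ_two]
  simp only [gram_eq, h, Matrix.of_apply]
  fin_cases i <;> fin_cases j <;> simp <;> field_simp <;> ring

theorem dgram_eq (m i j : Fin 2) (x : Chart) :
    dgram m i j x = -((if i = m then 1 else 0) * x j + x i * (if j = m then 1 else 0)) *
      (1 + ‖x‖ ^ 2)⁻¹ + 2 * x i * x j * x m * ((1 + ‖x‖ ^ 2)⁻¹) ^ 2 := by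
  have hp (i : Fin 2) : HasFDerivAt (fun y : Chart => y i) (EuclideanSpace.proj i : Chart →L[ℝ] ℝ) x :=
    (EuclideanSpace.proj i : Chart →L[ℝ] ℝ).hasFDerivAt
  have h1 : HasFDerivAt (fun x : Chart => 1 + ‖x‖ ^ 2) (2 • innerSL ℝ x) x :=
    (hasStrictFDerivAt_norm_sq x).hasFDerivAt.const_add 1
  have h2 := (hasDerivAt_inv (show 1 + ‖x‖ ^ 2 ≠ 0 by positivity)).comp_hasFDerivAt x h1
  have h3 := (((hp i).mul (hp j)).mul h2).const_sub (if i = j then (1 : ℝ) else 0)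
  have h4 : (fun y => gram y i j) = fun y => (if i = j then (1 : ℝ) else 0) -
      y i * y j * (Inv.inv ∘ fun x : Chart => 1 + ‖x‖ ^ 2) y := by
    ext y; rw [gram_eq]; rfl
  rw [dgram, h4]
  erw [h3.fderiv]
  simp [inner_basisVec]
  simp only [basisVec, PiLp.single_apply]
  split_ifs <;> ring

/-- The ambient acceleration of a geodesic is normal to the hyperboloid, hence a multiple of the
position vector. This makes the geodesic equation linear once the speed is fixed. -/
theorem christoffel_eq (k i j : Fin 2) (x : Chart) :
    christoffel k i j x = -gram x i j * x k := by
  have h : ‖x‖ ^ 2 = x 0 ^ 2 + x 1 ^ 2 := by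
    simp [EuclideanSpace.norm_sq_eq, Fin.sum_univ_two]
  have : 1 + (x 0 ^ 2 + x 1 ^ 2) ≠ 0 := by positivity
  rw [christoffel, inv_gram, gram_eq, Fin.sum_univ_two]
  simp only [dgram_eq, Matrix.of_apply, h]
  fin_cases i <;> fin_cases j <;> fin_cases k <;> simp <;> field_simp <;> ring

theorem hor_eq (z : TH) (Y : Chart) : hor z Y = (Y, metric z.1 Y z.2 • z.1) := by
  have h : ∀ v w : Chart, ⟪v, w⟫ = v 0 * w 0 + v 1 * w 1 := by
    intro v w
    simp [PiLp.inner_apply, Fin.sum_univ_two, mul_comm]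
  refine Prod.ext rfl ?_
  ext k
  simp only [hor, christoffel_eq, gram_eq, Fin.sum_univ_two, metric_eq, PiLp.smul_apply, smul_eq_mul, h]
  simp
  ring

/-- The squared speed of a tangent vector. -/
noncomputable def speedSq (z : TH) : ℝ := metric z.1 z.2 z.2

/-- The time component of the image of a tangent vector in Minkowski space. -/
noncomputable def slope (z : TH) : ℝ := ⟪z.1, z.2⟫ / height z.1

theorem slope_mul_height (z : TH) : slope z * height z.1 = ⟪z.1, z.2⟫ :=
  div_mul_cancel₀ _ (height_pos _).ne'

theorem speedSq_eq (z : TH) : speedSq z = ‖z.2‖ ^ 2 - slope z ^ 2 := by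
  rw [speedSq, metric_eq, real_inner_self_eq_norm_sq, slope, div_pow, height_sq, sq ⟪z.1, z.2⟫]

/-- Cauchy–Schwarz for `⟪z.1, z.2⟫`; the terms `‖z.1‖² slope²` cancel because `height² = 1 +
‖z.1‖²`. Positivity of the metric and its comparison with the Euclidean norm follow from it. -/
theorem slope_sq_le (z : TH) : slope z ^ 2 ≤ ‖z.1‖ ^ 2 * speedSq z := by
  have h1 := speedSq_eq z
  have h2 := slope_mul_height z
  have h3 := height_sq z.1
  have h4 : ⟪z.1, z.2⟫ ^ 2 ≤ ‖z.1‖ ^ 2 * ‖z.2‖ ^ 2 := by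
    rw [← mul_pow, ← sq_abs]
    exact pow_le_pow_left₀ (abs_nonneg _) (abs_real_inner_le_norm _ _) 2
  rw [← h2, mul_pow, h3] at h4
  rw [h1]
  linarith

theorem speedSq_nonneg (z : TH) : 0 ≤ speedSq z := by
  have h1 := speedSq_eq z
  have h2 := slope_sq_le z
  by_contra! h
  have : slope z ^ 2 ≤ 0 := by nlinarith [sq_nonneg ‖z.1‖]
  nlinarith [sq_nonneg ‖z.2‖]

theorem contDiff_speedSq {n : WithTop ℕ∞} : ContDiff ℝ n speedSq := by
  have : speedSq = fun z : TH => ⟪z.2, z.2⟫ - ⟪z.1, z.2⟫ * ⟪z.1, z.2⟫ / (1 + ‖z.1‖ ^ 2) := by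
    ext z; rw [speedSq, metric_eq]
  rw [this]
  have h : ContDiff ℝ n fun z : TH => ⟪z.1, z.2⟫ := contDiff_fst.inner ℝ contDiff_snd
  refine (contDiff_snd.inner ℝ contDiff_snd).sub ((h.mul h).div
    (contDiff_const.add ((contDiff_norm_sq ℝ).comp contDiff_fst)) fun z => by positivity)

theorem norm_sq_eq_speedSq_add (z : TH) : ‖z.2‖ ^ 2 ≤ (1 + ‖z.1‖ ^ 2) * speedSq z := by
  linarith [speedSq_eq z, slope_sq_le z]

end H2

/-! ### The functions `cosh √s` and `sinh √s / √s`, smooth across `s = 0`. -/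

/-- An everywhere convergent power series with factorially decaying coefficients is smooth. -/
theorem exists_contDiff_hasSum (c : ℕ → ℝ) (hc : ∀ n, c n ≠ 0)
    (hlim : Tendsto (fun n => ‖c n.succ‖ / ‖c n‖) atTop (𝓝 0)) :
    ∃ F : ℝ → ℝ, ContDiff ℝ 1 F ∧ ∀ s, HasSum (fun n => c n * s ^ n) (F s) := by
  have hr := FormalMultilinearSeries.ofScalars_radius_eq_top_of_tendsto (𝕜 := ℝ) ℝ c
    (Eventually.of_forall hc) hlim
  have hF := (FormalMultilinearSeries.ofScalars ℝ c).hasFPowerSeriesOnBall (by rw [hr]; simp)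
  rw [hr] at hF
  refine ⟨(FormalMultilinearSeries.ofScalars ℝ c).sum, ?_, fun s => ?_⟩
  · have := hF.analyticOnNhd.contDiffOn (n := 1) (by simp [uniqueDiffOn_univ])
    simpa [contDiffOn_univ] using this
  · have := hF.hasSum (y := s) (by simp)
    simpa [FormalMultilinearSeries.ofScalars_apply_eq, mul_comm] using this

theorem tendsto_norm_inv_factorial_ratio (j : ℕ) :
    Tendsto (fun n => ‖((2 * n.succ + j).factorial : ℝ)⁻¹‖ / ‖((2 * n + j).factorial : ℝ)⁻¹‖) atTop (𝓝 0) := by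
  have h : Tendsto (fun n : ℕ => ((n : ℝ) + 1)⁻¹) atTop (𝓝 0) := by
    simpa using tendsto_one_div_add_atTop_nhds_zero_nat (𝕜 := ℝ)
  refine squeeze_zero (fun n => by positivity) (fun n => ?_) h
  rw [show 2 * n.succ + j = (2 * n + j) + 1 + 1 by rw [Nat.succ_eq_add_one]; ring,
    Nat.factorial_succ (2 * n + j + 1), Nat.factorial_succ (2 * n + j)]
  have : 0 < ((2 * n + j).factorial : ℝ) := by positivity
  rw [norm_of_nonneg (by positivity), norm_of_nonneg (by positivity), div_inv_eq_mul]
  push_cast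
  rw [mul_inv, mul_inv, mul_assoc, mul_assoc, inv_mul_cancel₀ this.ne', mul_one, ← mul_inv]
  gcongr
  nlinarith [n.cast_nonneg (α := ℝ), j.cast_nonneg (α := ℝ),
    mul_nonneg (n.cast_nonneg (α := ℝ)) (j.cast_nonneg (α := ℝ))]

theorem exists_contDiff_cosh_sqrt :
    ∃ F : ℝ → ℝ, ContDiff ℝ 1 F ∧ ∀ w, F (w ^ 2) = cosh w := by
  obtain ⟨F, hF, hs⟩ := exists_contDiff_hasSum (fun n => ((2 * n + 0).factorial : ℝ)⁻¹)
    (fun n => by positivity) (tendsto_norm_inv_factorial_ratio 0)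
  refine ⟨F, hF, fun w => (hs (w ^ 2)).unique (by
    simpa only [← pow_mul, add_zero, div_eq_inv_mul] using Real.hasSum_cosh w)⟩

theorem exists_contDiff_sinh_sqrt :
    ∃ F : ℝ → ℝ, ContDiff ℝ 1 F ∧ F 0 = 1 ∧ ∀ w, w * F (w ^ 2) = sinh w := by
  obtain ⟨F, hF, hs⟩ := exists_contDiff_hasSum (fun n => ((2 * n + 1).factorial : ℝ)⁻¹)
    (fun n => by positivity) (tendsto_norm_inv_factorial_ratio 1)
  refine ⟨F, hF, ?_, fun w => ((hs (w ^ 2)).mul_left w).unique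
    ?_⟩
  · refine (hs 0).unique ?_
    have h : (fun n : ℕ => ((2 * n + 1).factorial : ℝ)⁻¹ * 0 ^ n) = fun n => if n = 0 then 1 else 0 := by
      ext n
      rcases n with _ | n <;> simp
    rw [h]
    exact hasSum_ite_eq 0 1
  · have h : (fun n : ℕ => w * (((2 * n + 1).factorial : ℝ)⁻¹ * (w ^ 2) ^ n)) =
        fun n => w ^ (2 * n + 1) / (2 * n + 1).factorial := by
      ext n
      rw [← pow_mul]
      ring
    rw [h]
    exact Real.hasSum_sinh w

namespace H2

/-- `cosh √s` as a smooth function of `s`. -/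
noncomputable def coshSqrt : ℝ → ℝ := exists_contDiff_cosh_sqrt.choose

/-- `sinh √s / √s` as a smooth function of `s`. -/
noncomputable def sinhSqrt : ℝ → ℝ := exists_contDiff_sinh_sqrt.choose

theorem contDiff_coshSqrt : ContDiff ℝ 1 coshSqrt := exists_contDiff_cosh_sqrt.choose_spec.1
theorem coshSqrt_sq (w : ℝ) : coshSqrt (w ^ 2) = cosh w := exists_contDiff_cosh_sqrt.choose_spec.2 w
theorem contDiff_sinhSqrt : ContDiff ℝ 1 sinhSqrt := exists_contDiff_sinh_sqrt.choose_spec.1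
theorem sinhSqrt_zero : sinhSqrt 0 = 1 := exists_contDiff_sinh_sqrt.choose_spec.2.1
theorem mul_sinhSqrt_sq (w : ℝ) : w * sinhSqrt (w ^ 2) = sinh w :=
  exists_contDiff_sinh_sqrt.choose_spec.2.2 w

/-- `cosh (t √s)`. -/
noncomputable def ch (t s : ℝ) : ℝ := coshSqrt (t ^ 2 * s)

/-- `sinh (t √s) / √s`. -/
noncomputable def sh (t s : ℝ) : ℝ := t * sinhSqrt (t ^ 2 * s)

theorem ch_sq (t w : ℝ) : ch t (w ^ 2) = cosh (t * w) := by
  rw [ch, ← mul_pow, coshSqrt_sq]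

theorem mul_sh_sq (t w : ℝ) : w * sh t (w ^ 2) = sinh (t * w) := by
  rw [sh, ← mul_pow, ← mul_sinhSqrt_sq]; ring

theorem ch_zero_right (t : ℝ) : ch t 0 = 1 := by simpa using ch_sq t 0

theorem sh_zero_right (t : ℝ) : sh t 0 = t := by simp [sh, sinhSqrt_zero]

theorem ch_zero_left (s : ℝ) : ch 0 s = 1 := by simpa [ch] using coshSqrt_sq 0

theorem sh_zero_left (s : ℝ) : sh 0 s = 0 := by simp [sh]

/-- Reduces the identities for `ch` and `sh` to those of `cosh` and `sinh`; zero is separate because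
`sh` requires division by `w`. -/
theorem exists_sq {s : ℝ} (hs : 0 ≤ s) : s = 0 ∨ ∃ w, w ≠ 0 ∧ s = w ^ 2 := by
  rcases hs.eq_or_lt with h | h
  · exact .inl h.symm
  · exact .inr ⟨√s, (Real.sqrt_pos.2 h).ne', (Real.sq_sqrt hs).symm⟩

theorem sh_sq {w : ℝ} (hw : w ≠ 0) (t : ℝ) : sh t (w ^ 2) = sinh (t * w) / w := by
  rw [← mul_sh_sq]; field_simp

theorem ch_sq_sub {s : ℝ} (hs : 0 ≤ s) (t : ℝ) : ch t s ^ 2 - s * sh t s ^ 2 = 1 := by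
  rcases exists_sq hs with rfl | ⟨w, -, rfl⟩
  · simp [ch_zero_right]
  · rw [ch_sq, ← mul_pow, mul_sh_sq, cosh_sq]; ring

theorem ch_add {s : ℝ} (hs : 0 ≤ s) (t t' : ℝ) :
    ch (t + t') s = ch t s * ch t' s + s * sh t s * sh t' s := by
  rcases exists_sq hs with rfl | ⟨w, -, rfl⟩
  · simp [ch_zero_right]
  · rw [ch_sq, ch_sq, ch_sq, add_mul, cosh_add, ← mul_sh_sq, ← mul_sh_sq]; ring

theorem sh_add {s : ℝ} (hs : 0 ≤ s) (t t' : ℝ) :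
    sh (t + t') s = sh t s * ch t' s + ch t s * sh t' s := by
  rcases exists_sq hs with rfl | ⟨w, hw, rfl⟩
  · simp [ch_zero_right, sh_zero_right]
  · rw [sh_sq hw, sh_sq hw, sh_sq hw, ch_sq, ch_sq, add_mul, sinh_add]; ring

theorem hasDerivAt_ch {s : ℝ} (hs : 0 ≤ s) (t : ℝ) :
    HasDerivAt (fun t => ch t s) (s * sh t s) t := by
  rcases exists_sq hs with rfl | ⟨w, -, rfl⟩
  · simpa [ch_zero_right] using hasDerivAt_const t (1 : ℝ)
  · simp only [ch_sq]
    have := (Real.hasDerivAt_cosh (t * w)).comp t ((hasDerivAt_id t).mul_const w)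
    refine this.congr_deriv ?_
    rw [← mul_sh_sq]; ring

theorem hasDerivAt_sh {s : ℝ} (hs : 0 ≤ s) (t : ℝ) :
    HasDerivAt (fun t => sh t s) (ch t s) t := by
  rcases exists_sq hs with rfl | ⟨w, hw, rfl⟩
  · simpa [ch_zero_right, sh_zero_right] using hasDerivAt_id' t
  · simp only [ch_sq, sh_sq hw]
    have := ((Real.hasDerivAt_sinh (t * w)).comp t ((hasDerivAt_id t).mul_const w)).div_const w
    refine this.congr_deriv ?_
    field_simp

theorem contDiff_ch : ContDiff ℝ 1 fun p : ℝ × ℝ => ch p.1 p.2 :=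
  contDiff_coshSqrt.comp ((contDiff_fst.pow 2).mul contDiff_snd)

theorem contDiff_sh : ContDiff ℝ 1 fun p : ℝ × ℝ => sh p.1 p.2 :=
  contDiff_fst.mul (contDiff_sinhSqrt.comp ((contDiff_fst.pow 2).mul contDiff_snd))

/-! ### The explicit geodesic flow. -/

/-- The geodesic flow. -/
noncomputable def flow (t : ℝ) (z : TH) : TH :=
  (ch t (speedSq z) • z.1 + sh t (speedSq z) • z.2,
    (speedSq z * sh t (speedSq z)) • z.1 + ch t (speedSq z) • z.2)

theorem contDiff_flow : ContDiff ℝ 1 fun p : ℝ × TH => flow p.1 p.2 := by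
  have hs : ContDiff ℝ 1 fun p : ℝ × TH => speedSq p.2 := contDiff_speedSq.comp contDiff_snd
  have hc : ContDiff ℝ 1 fun p : ℝ × TH => ch p.1 (speedSq p.2) :=
    contDiff_ch.comp (contDiff_fst.prodMk hs)
  have hsh : ContDiff ℝ 1 fun p : ℝ × TH => sh p.1 (speedSq p.2) :=
    contDiff_sh.comp (contDiff_fst.prodMk hs)
  have h1 : ContDiff ℝ 1 fun p : ℝ × TH => p.2.1 := contDiff_fst.comp contDiff_snd
  have h2 : ContDiff ℝ 1 fun p : ℝ × TH => p.2.2 := contDiff_snd.comp contDiff_snd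
  exact ((hc.smul h1).add (hsh.smul h2)).prodMk (((hs.mul hsh).smul h1).add (hc.smul h2))

theorem norm_flow_fst_sq (t : ℝ) (z : TH) : 1 + ‖(flow t z).1‖ ^ 2 =
    (ch t (speedSq z) * height z.1 + sh t (speedSq z) * slope z) ^ 2 := by
  have h1 := speedSq_eq z
  have h2 := slope_mul_height z
  have h3 := height_sq z.1
  have h4 := ch_sq_sub (speedSq_nonneg z) t
  rw [flow]
  simp only [norm_add_sq_real, norm_smul, mul_pow, inner_smul_left, inner_smul_right, norm_eq_abs,
    sq_abs, conj_trivial]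
  rw [← h2]
  linear_combination (- ch t (speedSq z) ^ 2) * h3 - sh t (speedSq z) ^ 2 * h1 - h4

theorem height_flow (t : ℝ) (z : TH) : height (flow t z).1 =
    ch t (speedSq z) * height z.1 + sh t (speedSq z) * slope z := by
  -- The sign is needed to extract the square root in `norm_flow_fst_sq`; by `slope_sq_le` the `sh`
  -- term cannot outweigh the `ch` term.
  have hpos : 0 ≤ ch t (speedSq z) * height z.1 + sh t (speedSq z) * slope z := by
    have h1 := slope_sq_le z
    have h3 := height_sq z.1
    have h4 := ch_sq_sub (speedSq_nonneg z) t
    have hs := speedSq_nonneg z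
    have hc : 0 ≤ ch t (speedSq z) := by
      rcases exists_sq hs with h | ⟨w, -, h⟩
      · simp [h, ch_zero_right]
      · rw [h, ch_sq]; exact (cosh_pos _).le
    have : |sh t (speedSq z) * slope z| ≤ ch t (speedSq z) * height z.1 := by
      apply abs_le_of_sq_le_sq _ (mul_nonneg hc (height_pos _).le)
      rw [mul_pow, mul_pow, h3]
      have := mul_le_mul_of_nonneg_left h1 (sq_nonneg (sh t (speedSq z)))
      have h5 : ch t (speedSq z) ^ 2 = 1 + speedSq z * sh t (speedSq z) ^ 2 := by linarith
      rw [h5]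
      have : 0 ≤ speedSq z * sh t (speedSq z) ^ 2 := by positivity
      nlinarith [sq_nonneg ‖z.1‖]
    linarith [neg_abs_le (sh t (speedSq z) * slope z)]
  rw [height, norm_flow_fst_sq, Real.sqrt_sq hpos]

theorem slope_flow (t : ℝ) (z : TH) : slope (flow t z) =
    speedSq z * sh t (speedSq z) * height z.1 + ch t (speedSq z) * slope z := by
  have h1 := speedSq_eq z
  have h2 := slope_mul_height z
  have h3 := height_sq z.1
  rw [slope, div_eq_iff (height_pos _).ne', height_flow]
  rw [flow]
  simp only [inner_add_left, inner_add_right, inner_smul_left, inner_smul_right, conj_trivial,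
    real_inner_self_eq_norm_sq, real_inner_comm z.1 z.2]
  rw [← h2]
  linear_combination (-ch t (speedSq z) * speedSq z * sh t (speedSq z)) * h3
    - sh t (speedSq z) * ch t (speedSq z) * h1

theorem speedSq_flow (t : ℝ) (z : TH) : speedSq (flow t z) = speedSq z := by
  have h1 := speedSq_eq z
  have h2 := slope_mul_height z
  have h3 := height_sq z.1
  have h4 := ch_sq_sub (speedSq_nonneg z) t
  rw [speedSq_eq, slope_flow]
  have : ‖(flow t z).2‖ ^ 2 = (speedSq z * sh t (speedSq z)) ^ 2 * ‖z.1‖ ^ 2 +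
    2 * (speedSq z * sh t (speedSq z) * ch t (speedSq z)) * ⟪z.1, z.2⟫ +
    ch t (speedSq z) ^ 2 * ‖z.2‖ ^ 2 := by
    rw [flow]
    simp only [norm_add_sq_real, norm_smul, mul_pow, inner_smul_left, inner_smul_right, norm_eq_abs,
      sq_abs, conj_trivial]
    ring
  rw [this, ← h2]
  linear_combination (-(speedSq z * sh t (speedSq z)) ^ 2) * h3
    - ch t (speedSq z) ^ 2 * h1 + speedSq z * h4

/-- As the speed is constant along orbits, both flows use the same `s` in `ch` and `sh`, and the
addition formulas suffice. -/
theorem flow_add (t t' : ℝ) (z : TH) : flow (t + t') z = flow t (flow t' z) := by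
  have hs := speedSq_nonneg z
  rw [flow, flow, speedSq_flow, flow, ch_add hs, sh_add hs]
  refine Prod.ext ?_ ?_ <;> (simp only; module)

theorem flow_zero (z : TH) : flow 0 z = z := by
  simp [flow, ch_zero_left, sh_zero_left]

theorem flow_neg_flow (t : ℝ) (z : TH) : flow (-t) (flow t z) = z := by
  rw [← flow_add]; simp [flow_zero]

theorem flow_flow_neg (t : ℝ) (z : TH) : flow t (flow (-t) z) = z := by
  rw [← flow_add]; simp [flow_zero]

theorem geodesicField_eq (z : TH) : geodesicField z = (z.2, speedSq z • z.1) := by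
  rw [geodesicField, hor_eq, speedSq]

theorem hasDerivAt_flow (t : ℝ) (z : TH) :
    HasDerivAt (fun t => flow t z) (geodesicField (flow t z)) t := by
  have hs := speedSq_nonneg z
  have hc := hasDerivAt_ch hs t
  have hsh := hasDerivAt_sh hs t
  have := ((hc.smul_const z.1).add (hsh.smul_const z.2)).prodMk
    (((hsh.const_mul (speedSq z)).smul_const z.1).add (hc.smul_const z.2))
  refine this.congr_deriv ?_
  rw [geodesicField_eq, speedSq_flow, flow]
  refine Prod.ext ?_ ?_ <;> module

/-! ### Solving the Vlasov equation by characteristics. -/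

/-- The derivative along an orbit is the Vlasov operator. Uniqueness reads this from equation to
constancy, existence from constancy to equation. -/
theorem hasDerivWithinAt_along_flow {F : ℝ × TH → ℝ} {t : ℝ} (ht : 0 ≤ t) {z : TH}
    (hF : DifferentiableWithinAt ℝ F (Ici 0 ×ˢ univ) (t, flow t z)) :
    HasDerivWithinAt (fun s => F (s, flow s z))
      (derivWithin (fun s => F (s, flow t z)) (Ici 0) t +
        fderiv ℝ (fun w => F (t, w)) (flow t z) (geodesicField (flow t z))) (Ici 0) t := by
  set L := fderivWithin ℝ F (Ici 0 ×ˢ univ) (t, flow t z)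
  have hL : HasFDerivWithinAt F L (Ici 0 ×ˢ univ) (t, flow t z) := hF.hasFDerivWithinAt
  have h1 : HasDerivWithinAt (fun s => F (s, flow t z)) (L (1, 0)) (Ici 0) t :=
    hL.comp_hasDerivWithinAt t (f := fun s => (s, flow t z))
      ((hasDerivWithinAt_id t _).prodMk (hasDerivWithinAt_const t _ _)) fun s hs => ⟨hs, mem_univ _⟩
  have h2 : HasFDerivAt (fun w => F (t, w)) (L.comp (ContinuousLinearMap.inr ℝ ℝ TH)) (flow t z) := by
    rw [← hasFDerivWithinAt_univ]
    exact hL.comp (flow t z) (f := fun w => (t, w))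
      (hasFDerivAt_prodMk_right t (flow t z)).hasFDerivWithinAt fun s _ => ⟨ht, mem_univ _⟩
  have h3 : HasDerivWithinAt (fun s => F (s, flow s z)) (L (1, geodesicField (flow t z))) (Ici 0) t :=
    hL.comp_hasDerivWithinAt t (f := fun s => (s, flow s z))
      ((hasDerivWithinAt_id t _).prodMk (hasDerivAt_flow t z).hasDerivWithinAt)
      fun s hs => ⟨hs, mem_univ _⟩
  rw [h1.derivWithin (uniqueDiffOn_Ici 0 t ht), h2.fderiv]
  refine h3.congr_deriv ?_
  simp [← map_add]

theorem IsVlasovField.eq_flow {f₀ : TH → ℝ} {f : ℝ → TH → ℝ} (h : IsVlasovField f₀ f) {t : ℝ}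
    (ht : 0 ≤ t) (z : TH) : f t z = f₀ (flow (-t) z) := by
  have key : ∀ s, 0 ≤ s → ∀ w,
      HasDerivWithinAt (fun s => f s (flow s w)) 0 (Ici 0) s := fun s hs w => by
    have := hasDerivWithinAt_along_flow hs (F := fun p => f p.1 p.2) (z := w)
      ((h.contDiffOn.differentiableOn one_ne_zero) _ ⟨hs, mem_univ _⟩)
    rwa [h.equation s hs] at this
  have hc : ContinuousOn (fun s => f s (flow s (flow (-t) z))) (Icc 0 t) := fun s hs =>
    (key s hs.1 (flow (-t) z)).continuousWithinAt.mono Icc_subset_Ici_self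
  have := constant_of_has_deriv_right_zero hc
    (fun s hs => (key s hs.1 (flow (-t) z)).mono (Ici_subset_Ici.2 hs.1)) t ⟨ht, le_rfl⟩
  simpa [flow_flow_neg, flow_zero, h.initial] using this

theorem isVlasovField_flow {f₀ : TH → ℝ} (hf : ContDiff ℝ 1 f₀) :
    IsVlasovField f₀ fun t z => f₀ (flow (-t) z) := by
  have hF : ContDiff ℝ 1 fun p : ℝ × TH => f₀ (flow (-p.1) p.2) :=
    hf.comp (contDiff_flow.comp (f := fun p : ℝ × TH => (-p.1, p.2))
      (contDiff_fst.neg.prodMk contDiff_snd))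
  have hF' := hF.contDiffOn (s := Ici 0 ×ˢ univ)
  refine ⟨hF', funext fun z => by rw [neg_zero, flow_zero], fun t ht z => ?_⟩
  -- The orbit is started at `flow (-t) z` so that it passes through `z` at time `t`.
  have h := hasDerivWithinAt_along_flow (F := fun p : ℝ × TH => f₀ (flow (-p.1) p.2)) ht (z := flow (-t) z)
    (hF.differentiable one_ne_zero (t, flow t (flow (-t) z))).differentiableWithinAt
  simp only [flow_flow_neg, flow_neg_flow] at h
  exact h.derivWithin (uniqueDiffOn_Ici 0 t ht) ▸
    (hasDerivWithinAt_const t (Ici 0) (f₀ (flow (-t) z))).derivWithin (uniqueDiffOn_Ici 0 t ht)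

end H2

/-! ### Differentiation under the integral sign. -/

/-- Differentiation under an integral over a compact set. -/
theorem hasFDerivAt_setIntegral_of_contDiffOn {H E : Type*} [NormedAddCommGroup H] [NormedSpace ℝ H]
    [ProperSpace H] [NormedAddCommGroup E] [NormedSpace ℝ E] [MeasurableSpace E] [BorelSpace E]
    [SecondCountableTopology E] {μ : Measure E} [IsFiniteMeasureOnCompacts μ] {G : H × E → ℝ}
    {W : Set (H × E)} (hW : IsOpen W) (hG : ContDiffOn ℝ 1 G W) {K : Set E} (hK : IsCompact K)
    {U : Set H} (hU : IsOpen U) (hUK : U ×ˢ K ⊆ W) {x : H} (hx : x ∈ U) :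
    HasFDerivAt (fun x => ∫ y in K, G (x, y) ∂μ)
      (∫ y in K, (fderiv ℝ G (x, y)).comp (ContinuousLinearMap.inl ℝ H E) ∂μ) x ∧
    IntegrableOn (fun y => (fderiv ℝ G (x, y)).comp (ContinuousLinearMap.inl ℝ H E)) K μ := by
  obtain ⟨r, hr, hrU⟩ := Metric.nhds_basis_closedBall.mem_iff.1 (hU.mem_nhds hx)
  set G' : H × E → H →L[ℝ] ℝ := fun p => (fderiv ℝ G p).comp (ContinuousLinearMap.inl ℝ H E)
  have hG' : ContinuousOn G' W :=
    (hG.continuousOn_fderiv_of_isOpen hW le_rfl).clm_comp continuousOn_const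
  have hsub : Metric.closedBall x r ×ˢ K ⊆ W := (prod_mono_left hrU).trans hUK
  obtain ⟨C, hC⟩ := ((isCompact_closedBall x r).prod hK).exists_bound_of_continuousOn (hG'.mono hsub)
  have hmk : ∀ x : H, ContinuousOn (fun y : E => (x, y)) K := fun x => by fun_prop
  have hmaps : ∀ x ∈ U, MapsTo (fun y : E => (x, y)) K W := fun x hx y hy => hUK ⟨hx, hy⟩
  refine ⟨hasFDerivAt_integral_of_dominated_of_fderiv_le (F' := fun x y => G' (x, y))
    (bound := fun _ => C) (Metric.closedBall_mem_nhds x hr) ?_ ?_ ?_ ?_ ?_ ?_, ?_⟩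
  · filter_upwards [hU.mem_nhds hx] with x' hx'
    exact (hG.continuousOn.comp (hmk x') (hmaps x' hx')).aestronglyMeasurable hK.measurableSet
  · exact (hG.continuousOn.comp (hmk x) (hmaps x hx)).integrableOn_compact hK
  · exact (hG'.comp (hmk x) (hmaps x hx)).aestronglyMeasurable hK.measurableSet
  · refine (ae_restrict_iff' hK.measurableSet).2 (.of_forall fun y hy x' hx' => ?_)
    exact hC _ ⟨hx', hy⟩
  · exact integrableOn_const hK.measure_ne_top
  · refine (ae_restrict_iff' hK.measurableSet).2 (.of_forall fun y hy x' hx' => ?_)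
    have h1 : HasFDerivAt G (fderiv ℝ G (x', y)) (x', y) :=
      (hG.differentiableOn one_ne_zero |>.differentiableAt
        (hW.mem_nhds (hsub ⟨hx', hy⟩))).hasFDerivAt
    exact h1.comp x' (hasFDerivAt_prodMk_left x' y)
  · exact (hG'.comp (hmk x) (hmaps x hx)).integrableOn_compact hK

/-- Differentiation with respect to a real parameter under an integral over a compact interval. -/
theorem hasDerivAt_setIntegral_Icc {G G' : ℝ × ℝ → ℝ} {W : Set (ℝ × ℝ)} (hW : IsOpen W)
    (hG : ContDiffOn ℝ 1 G W)
    (hG' : ∀ p ∈ W, HasDerivAt (fun e => G (e, p.2)) (G' p) p.1) {U : Set ℝ} {a b : ℝ}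
    (hU : IsOpen U) (hUK : U ×ˢ Icc a b ⊆ W) {x : ℝ} (hx : x ∈ U) :
    HasDerivAt (fun x => ∫ y in Icc a b, G (x, y)) (∫ y in Icc a b, G' (x, y)) x := by
  obtain ⟨h1, h2⟩ := hasFDerivAt_setIntegral_of_contDiffOn (μ := volume) hW hG
    (isCompact_Icc (a := a) (b := b)) hU hUK hx
  refine h1.hasDerivAt.congr_deriv ?_
  rw [ContinuousLinearMap.integral_apply h2]
  refine setIntegral_congr_fun measurableSet_Icc fun y hy => ?_
  have hp := hUK (mk_mem_prod hx hy)
  have h3 : HasFDerivAt G (fderiv ℝ G (x, y)) (x, y) :=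
    (hG.differentiableOn one_ne_zero |>.differentiableAt (hW.mem_nhds hp)).hasFDerivAt
  exact (h3.comp x (hasFDerivAt_prodMk_left x y)).hasDerivAt.unique (hG' _ hp)

namespace H2

/-! ### The function `τ / sinh τ` in terms of `e = cosh τ`. -/

/-- The function `arcosh e / √(e ^ 2 - 1)`, as an integral which is smooth in `e > 0`. -/
noncomputable def arc (e : ℝ) : ℝ := ∫ u in Icc (0 : ℝ) 1, 2 / (1 + 2 * e * u + u ^ 2)

/-- The derivative of `arc`. -/
noncomputable def arcDeriv (e : ℝ) : ℝ :=
  ∫ u in Icc (0 : ℝ) 1, -(4 * u) / (1 + 2 * e * u + u ^ 2) ^ 2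

theorem isOpen_arcDomain : IsOpen {p : ℝ × ℝ | 0 < 1 + 2 * p.1 * p.2 + p.2 ^ 2} :=
  isOpen_lt continuous_const (by fun_prop)

theorem Ioi_prod_Icc_subset_arcDomain :
    Ioi (0 : ℝ) ×ˢ Icc (0 : ℝ) 1 ⊆ {p : ℝ × ℝ | 0 < 1 + 2 * p.1 * p.2 + p.2 ^ 2} := by
  rintro ⟨e, u⟩ ⟨he, hu, -⟩
  simp only [mem_Ioi, mem_ofPred_eq] at *
  positivity

theorem hasDerivAt_arc {e : ℝ} (he : 0 < e) : HasDerivAt arc (arcDeriv e) e := by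
  refine hasDerivAt_setIntegral_Icc (G := fun p => 2 / (1 + 2 * p.1 * p.2 + p.2 ^ 2))
    (G' := fun p => -(4 * p.2) / (1 + 2 * p.1 * p.2 + p.2 ^ 2) ^ 2) isOpen_arcDomain ?_ ?_
    isOpen_Ioi Ioi_prod_Icc_subset_arcDomain (mem_Ioi.2 he)
  · exact contDiffOn_const.div (ContDiff.contDiffOn (by fun_prop)) fun p hp => ne_of_gt hp
  · rintro ⟨e, u⟩ hp
    simp only [mem_ofPred_eq] at hp
    have h1 : HasDerivAt (fun e : ℝ => 1 + 2 * e * u + u ^ 2) (2 * u) e := by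
      simpa using ((((hasDerivAt_id' e).const_mul 2).mul_const u).const_add 1).add_const (u ^ 2)
    refine ((hasDerivAt_const e 2).div h1 hp.ne').congr_deriv ?_
    simp only
    ring

theorem differentiableAt_arcDeriv {e : ℝ} (he : 0 < e) : DifferentiableAt ℝ arcDeriv e := by
  refine (hasDerivAt_setIntegral_Icc
    (G := fun p => -(4 * p.2) / (1 + 2 * p.1 * p.2 + p.2 ^ 2) ^ 2)
    (G' := fun p => deriv (fun e => -(4 * p.2) / (1 + 2 * e * p.2 + p.2 ^ 2) ^ 2) p.1)
    isOpen_arcDomain ?_ ?_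
    isOpen_Ioi Ioi_prod_Icc_subset_arcDomain (mem_Ioi.2 he)).differentiableAt
  · exact ContDiffOn.div (ContDiff.contDiffOn (by fun_prop)) (ContDiff.contDiffOn (by fun_prop))
      fun p hp => pow_ne_zero 2 (ne_of_gt hp)
  · rintro ⟨e, u⟩ hp
    simp only [mem_ofPred_eq] at hp
    exact (DifferentiableAt.div (𝕜 := ℝ) (c := fun _ => -(4 * u))
      (d := fun e => (1 + 2 * e * u + u ^ 2) ^ 2) (by fun_prop) (by fun_prop)
      (pow_ne_zero 2 hp.ne')).hasDerivAt

theorem contDiffOn_arc : ContDiffOn ℝ 1 arc (Ioi 0) := by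
  rw [← zero_add (1 : WithTop ℕ∞), contDiffOn_succ_iff_deriv_of_isOpen isOpen_Ioi]
  refine ⟨fun e he => (hasDerivAt_arc he).differentiableAt.differentiableWithinAt, by simp, ?_⟩
  rw [contDiffOn_zero]
  refine ContinuousOn.congr (f := arcDeriv) (fun e he => ?_) fun e he => (hasDerivAt_arc he).deriv
  exact (differentiableAt_arcDeriv he).continuousAt.continuousWithinAt

/-- The denominator has roots `-exp (±τ)`, so partial fractions give a difference of logarithms.
Keeping the factor `sinh τ` avoids dividing at `τ = 0`. -/
theorem arc_cosh_mul_sinh (τ : ℝ) : arc (cosh τ) * sinh τ = τ := by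
  have key : ∀ u : ℝ, 1 + 2 * cosh τ * u + u ^ 2 = (u + exp (-τ)) * (u + exp τ) := fun u => by
    rw [cosh_eq]
    have : exp (-τ) * exp τ = 1 := by rw [← exp_add]; simp
    linear_combination -this
  have hd : ∀ u ∈ uIcc (0 : ℝ) 1, HasDerivAt (fun u => log (u + exp (-τ)) - log (u + exp τ))
      (2 / (1 + 2 * cosh τ * u + u ^ 2) * sinh τ) u := fun u hu => by
    rw [uIcc_of_le zero_le_one] at hu
    have h1 : u + exp (-τ) ≠ 0 := by have := exp_pos (-τ); linarith [hu.1]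
    have h2 : u + exp τ ≠ 0 := by have := exp_pos τ; linarith [hu.1]
    refine (((hasDerivAt_id' u).add_const _ |>.log h1).sub
      ((hasDerivAt_id' u).add_const _ |>.log h2)).congr_deriv ?_
    rw [key, sinh_eq]
    field_simp
    ring
  have hcont : ContinuousOn (fun u => 2 / (1 + 2 * cosh τ * u + u ^ 2) * sinh τ) (uIcc 0 1) := by
    refine ContinuousOn.mul (continuousOn_const.div (by fun_prop) fun u hu => ?_) continuousOn_const
    rw [uIcc_of_le zero_le_one] at hu
    have := cosh_pos τ
    have := hu.1
    positivity
  have := intervalIntegral.integral_eq_sub_of_hasDerivAt hd hcont.intervalIntegrable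
  rw [intervalIntegral.integral_of_le zero_le_one, ← integral_Icc_eq_integral_Ioc,
    integral_mul_const] at this
  rw [arc, this, zero_add, zero_add, log_exp, log_exp,
    show 1 + exp τ = exp τ * (1 + exp (-τ)) by rw [mul_add, ← exp_add]; simp [add_comm],
    log_mul (exp_pos _).ne' (by positivity), log_exp]
  ring

theorem exists_cosh_eq {e : ℝ} (he : 1 ≤ e) : ∃ τ, 0 ≤ τ ∧ cosh τ = e :=
  ⟨arcosh e, arcosh_nonneg he, cosh_arcosh he⟩

/-- Obtained by differentiating `arc (cosh τ) * sinh τ = τ`. It collapses the Jacobian and controls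
`arcDeriv` for large `e`. -/
theorem arc_ode {e : ℝ} (he : 1 ≤ e) : (e ^ 2 - 1) * arcDeriv e + e * arc e = 1 := by
  obtain ⟨τ, -, rfl⟩ := exists_cosh_eq he
  have h1 : HasDerivAt (fun τ => arc (cosh τ) * sinh τ) _ τ :=
    ((hasDerivAt_arc (cosh_pos τ)).comp τ (hasDerivAt_cosh τ)).mul (hasDerivAt_sinh τ)
  have h2 : (fun τ => arc (cosh τ) * sinh τ) = fun τ => τ := funext arc_cosh_mul_sinh
  rw [h2] at h1
  have := h1.unique (hasDerivAt_id' τ)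
  simp only [Function.comp] at this
  rw [cosh_sq]
  linear_combination this

theorem arc_one : arc 1 = 1 := by simpa using arc_ode le_rfl

theorem arc_pos {e : ℝ} (he : 1 ≤ e) : 0 < arc e := by
  obtain ⟨τ, hτ, rfl⟩ := exists_cosh_eq he
  rcases hτ.eq_or_lt with rfl | h
  · simp [arc_one]
  · have := arc_cosh_mul_sinh τ
    have := sinh_pos_iff.2 h
    by_contra! h'
    nlinarith

theorem norm_setIntegral_Icc_zero_one_le {g : ℝ → ℝ} {C : ℝ} (h : ∀ u ∈ Icc (0 : ℝ) 1, ‖g u‖ ≤ C) :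
    ‖∫ u in Icc (0 : ℝ) 1, g u‖ ≤ C := by
  simpa using norm_setIntegral_le_of_norm_le_const (μ := volume) (by simp) h

theorem arc_le {e : ℝ} (he : 1 ≤ e) : arc e ≤ 2 := by
  refine (le_abs_self _).trans (norm_setIntegral_Icc_zero_one_le fun u hu => ?_)
  have h0 := hu.1
  rw [norm_of_nonneg (by positivity)]
  exact div_le_self zero_le_two (by nlinarith [mul_nonneg (zero_le_one.trans he) h0])

theorem abs_arcDeriv_mul_le {e : ℝ} (he : 1 ≤ e) : |arcDeriv e| * e ≤ 2 := by
  rw [← le_div_iff₀ (by positivity)]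
  refine norm_setIntegral_Icc_zero_one_le fun u hu => ?_
  have h0 := hu.1
  have h1 : 0 ≤ e * u := mul_nonneg (zero_le_one.trans he) h0
  rw [neg_div, norm_neg, norm_of_nonneg (by positivity), div_le_div_iff₀ (by positivity) (by positivity)]
  nlinarith [sq_nonneg u, mul_nonneg h1 (sq_nonneg u), mul_nonneg h1 h1]

/-- Write `e² = (e² - 1) + 1`: the ODE bounds the first part by `1 + e * arc e`, and
`abs_arcDeriv_mul_le` bounds the second by `2`. -/
theorem abs_arcDeriv_mul_sq_le {e : ℝ} (he : 1 ≤ e) : |arcDeriv e| * e ^ 2 ≤ 3 + e * arc e := by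
  have h1 := abs_arcDeriv_mul_le he
  have h2 : |arcDeriv e| * (e ^ 2 - 1) ≤ 1 + e * arc e := by
    have := arc_pos he
    rw [← abs_of_nonneg (show 0 ≤ e ^ 2 - 1 by nlinarith), ← abs_mul, abs_le]
    constructor <;> nlinarith [arc_ode he, mul_pos (zero_lt_one.trans_le he) this]
  nlinarith [abs_nonneg (arcDeriv e)]

/-- `t = arc (cosh (t √s)) * sinh (t √s) / √s`. -/
theorem arc_ch_mul_sh {s : ℝ} (hs : 0 ≤ s) (t : ℝ) : arc (ch t s) * sh t s = t := by
  rcases exists_sq hs with rfl | ⟨w, hw, rfl⟩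
  · simp [ch_zero_right, sh_zero_right, arc_one]
  · rw [ch_sq, sh_sq hw, ← mul_div_assoc, arc_cosh_mul_sinh]
    field_simp

/-! ### Distance, inverse exponential map and its Jacobian. -/

/-- The hyperbolic cosine of the distance of two points. -/
noncomputable def coshDist (x y : Chart) : ℝ := height x * height y - ⟪x, y⟫

/-- The inverse of the exponential map at `x`. -/
noncomputable def logMap (x y : Chart) : Chart := arc (coshDist x y) • (y - coshDist x y • x)

theorem coshDist_comm (x y : Chart) : coshDist x y = coshDist y x := by
  rw [coshDist, coshDist, real_inner_comm, mul_comm]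

theorem one_le_coshDist (x y : Chart) : 1 ≤ coshDist x y := by
  have h : 1 + ‖x‖ * ‖y‖ ≤ height x * height y := by
    apply abs_le_of_sq_le_sq' _ (mul_nonneg (height_pos x).le (height_pos y).le) |>.2
    rw [mul_pow, height_sq, height_sq]
    nlinarith [sq_nonneg (‖x‖ - ‖y‖)]
  have := real_inner_le_norm x y
  rw [coshDist]
  linarith

/-- A form of the triangle inequality through the origin, `height` being the `cosh` of the distance
to it. The proof uses `(height x - ‖x‖) * (height x + ‖x‖) = 1`. -/
theorem height_le_coshDist (x y : Chart) : height y ≤ 2 * height x * coshDist x y := by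
  have h1 := real_inner_le_norm x y
  have h2 := norm_le_height x
  have h3 := norm_le_height y
  have h4 := height_sq x
  have h5 : height y * (height x - ‖x‖) ≤ coshDist x y := by
    rw [coshDist]
    nlinarith [mul_le_mul_of_nonneg_left h3 (norm_nonneg x)]
  have h6 : height y = height y * (height x - ‖x‖) * (height x + ‖x‖) := by
    linear_combination (-height y) * h4
  have h7 := zero_le_one.trans (one_le_coshDist x y)
  calc height y = height y * (height x - ‖x‖) * (height x + ‖x‖) := h6
    _ ≤ coshDist x y * (height x + ‖x‖) := by
      gcongr
      exact add_nonneg (height_pos x).le (norm_nonneg x)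
    _ ≤ coshDist x y * (height x + height x) := by gcongr
    _ = _ := by ring

theorem coshDist_flow (t : ℝ) (z : TH) : coshDist z.1 (flow t z).1 = ch t (speedSq z) := by
  have h2 := slope_mul_height z
  have h3 := height_sq z.1
  rw [coshDist, height_flow, flow]
  simp only [inner_add_right, inner_smul_right, real_inner_self_eq_norm_sq]
  rw [← h2]
  linear_combination ch t (speedSq z) * h3

/-- Subtracting `ch • z.1` from the endpoint leaves `sh • z.2`, and `arc (ch) * sh = t`. With
`flow_one_logMap` this makes `logMap x` a bijection. -/
theorem logMap_flow (t : ℝ) (z : TH) : logMap z.1 (flow t z).1 = t • z.2 := by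
  rw [logMap, coshDist_flow, flow]
  simp only [add_sub_cancel_left, smul_smul, arc_ch_mul_sh (speedSq_nonneg z)]

theorem speedSq_sub_smul (x y : Chart) :
    speedSq (x, y - coshDist x y • x) = coshDist x y ^ 2 - 1 := by
  have hx := height_sq x
  have hy := height_sq y
  have h0 := (height_pos x).ne'
  have h1 : slope (x, y - coshDist x y • x) = height y - coshDist x y * height x := by
    rw [slope, div_eq_iff h0]
    simp only [inner_sub_right, inner_smul_right, real_inner_self_eq_norm_sq]
    rw [coshDist]
    linear_combination (height x * height y - ⟪x, y⟫) * hx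
  rw [speedSq_eq, h1]
  simp only [norm_sub_sq_real, norm_smul, mul_pow, inner_smul_right, norm_eq_abs, sq_abs]
  rw [real_inner_comm]
  have h2 : ⟪x, y⟫ = height x * height y - coshDist x y := by rw [coshDist]; ring
  rw [h2]
  linear_combination (-1 : ℝ) * hy - coshDist x y ^ 2 * hx

theorem speedSq_smul (a : ℝ) (x v : Chart) : speedSq (x, a • v) = a ^ 2 * speedSq (x, v) := by
  simp only [speedSq, metric_eq, inner_smul_left, inner_smul_right, conj_trivial]
  ring

theorem speedSq_logMap (x y : Chart) :
    speedSq (x, logMap x y) = arc (coshDist x y) ^ 2 * (coshDist x y ^ 2 - 1) := by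
  rw [logMap, speedSq_smul, speedSq_sub_smul]

theorem flow_one_logMap (x y : Chart) : (flow 1 (x, logMap x y)).1 = y := by
  obtain ⟨τ, hτ, h⟩ := exists_cosh_eq (one_le_coshDist x y)
  have hs : speedSq (x, logMap x y) = τ ^ 2 := by
    rw [speedSq_logMap, ← h, cosh_sq, add_sub_cancel_right, ← mul_pow, arc_cosh_mul_sinh]
  have hc : ch 1 (τ ^ 2) = coshDist x y := by rw [ch_sq, one_mul, h]
  have hm := arc_ch_mul_sh (sq_nonneg τ) 1
  rw [hc] at hm
  rw [flow, hs, hc]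
  simp only [logMap, smul_smul]
  rw [mul_comm, hm]
  module

theorem logMap_injective (x : Chart) : Function.Injective (logMap x) := fun y y' h => by
  rw [← flow_one_logMap x y, h, flow_one_logMap]

/-- The initial state of the particle which sits at `x` at time `t` and came from `y`. -/
theorem flow_neg_logMap {t : ℝ} (ht : t ≠ 0) (x y : Chart) :
    flow (-t) (x, (-t)⁻¹ • logMap x y) = (y, t⁻¹ • logMap y x) := by
  set z : TH := (x, (-t)⁻¹ • logMap x y)
  have h1 : (flow (-t) z).1 = y := by
    apply logMap_injective x
    have := logMap_flow (-t) z
    rwa [smul_inv_smul₀ (neg_ne_zero.2 ht)] at this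
  refine Prod.ext h1 ?_
  have := logMap_flow t (flow (-t) z)
  rw [flow_flow_neg, h1] at this
  rw [this, inv_smul_smul₀ ht]

theorem surjective_smul_logMap {t : ℝ} (ht : t ≠ 0) (x : Chart) :
    Function.Surjective fun y => (-t)⁻¹ • logMap x y := fun v =>
  ⟨(flow (-t) (x, v)).1, by
    have := logMap_flow (-t) (x, v)
    simp only at this
    simp only [this, inv_smul_smul₀ (neg_ne_zero.2 ht)]⟩

/-- The differential of `coshDist x` at `y`. -/
noncomputable def coshDistDeriv (x y : Chart) : Chart →L[ℝ] ℝ :=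
  (height x * (height y)⁻¹) • innerSL ℝ y - innerSL ℝ x

theorem hasFDerivAt_coshDist (x y : Chart) : HasFDerivAt (coshDist x) (coshDistDeriv x y) y := by
  refine (((hasFDerivAt_height y).const_mul (height x)).sub (innerSL ℝ x).hasFDerivAt).congr_fderiv ?_
  rw [coshDistDeriv, smul_smul]

theorem hasFDerivAt_arc_coshDist (x y : Chart) : HasFDerivAt (fun y => arc (coshDist x y))
    (arcDeriv (coshDist x y) • coshDistDeriv x y) y :=
  (hasDerivAt_arc (zero_lt_one.trans_le (one_le_coshDist x y))).comp_hasFDerivAt y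
    (hasFDerivAt_coshDist x y)

/-- The differential of `logMap x` at `y`. -/
noncomputable def logMapDeriv (x y : Chart) : Chart →L[ℝ] Chart :=
  arc (coshDist x y) • ContinuousLinearMap.id ℝ Chart +
    (coshDistDeriv x y).smulRight
      (arcDeriv (coshDist x y) • (y - coshDist x y • x) - arc (coshDist x y) • x)

theorem hasFDerivAt_logMap (x y : Chart) : HasFDerivAt (logMap x) (logMapDeriv x y) y := by
  have h := (hasFDerivAt_arc_coshDist x y).smul
    ((hasFDerivAt_id y).sub ((hasFDerivAt_coshDist x y).smul_const x))
  refine h.congr_fderiv ?_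
  ext1 v
  simp only [logMapDeriv, add_apply, smul_apply,
    ContinuousLinearMap.smulRight_apply, sub_apply, ContinuousLinearMap.id_apply,
    Pi.sub_apply, id_eq, smul_eq_mul]
  module

/-- The scalar that the rank-one part contributes to the determinant; expanded, it is `arc_ode`
multiplied by `height x / height y`. -/
theorem arc_add_coshDistDeriv (x y : Chart) : arc (coshDist x y) + coshDistDeriv x y
    (arcDeriv (coshDist x y) • (y - coshDist x y • x) - arc (coshDist x y) • x) =
      height x / height y := by
  have hx := height_sq x
  have hy := height_sq y
  have h0 := (height_pos y).ne'
  have hode := arc_ode (one_le_coshDist x y)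
  have h2 : ⟪x, y⟫ = height x * height y - coshDist x y := by rw [coshDist]; ring
  simp only [coshDistDeriv, sub_apply, smul_apply,
    innerSL_apply_apply, inner_sub_right, inner_smul_right, real_inner_self_eq_norm_sq, smul_eq_mul]
  rw [real_inner_comm x y, h2, show ‖x‖ ^ 2 = height x ^ 2 - 1 by linarith,
    show ‖y‖ ^ 2 = height y ^ 2 - 1 by linarith]
  field_simp
  linear_combination height x * hode

/-- The differential is `arc` times the identity plus a rank-one map `φ ⊗ p / arc`, so in dimension
two its determinant is `arc² (1 + φ(p) / arc)`. -/
theorem det_logMapDeriv (x y : Chart) :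
    (logMapDeriv x y).det = arc (coshDist x y) * (height x / height y) := by
  have ha := (arc_pos (one_le_coshDist x y)).ne'
  set p := arcDeriv (coshDist x y) • (y - coshDist x y • x) - arc (coshDist x y) • x with hp
  have h : (logMapDeriv x y : Chart →ₗ[ℝ] Chart) = arc (coshDist x y) •
      LinearMap.transvection (coshDistDeriv x y : Chart →ₗ[ℝ] ℝ) ((arc (coshDist x y))⁻¹ • p) := by
    ext1 v
    simp only [logMapDeriv, ← hp, LinearMap.smul_apply, LinearMap.transvection.apply, smul_add,
      ContinuousLinearMap.coe_coe, add_apply, smul_apply,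
      ContinuousLinearMap.smulRight_apply, ContinuousLinearMap.id_apply]
    rw [smul_comm, smul_inv_smul₀ ha]
  rw [ContinuousLinearMap.det, h, LinearMap.det_smul, LinearMap.transvection.det,
    ← arc_add_coshDistDeriv, finrank_euclideanSpace_fin, ← hp, map_smul, smul_eq_mul,
    ContinuousLinearMap.coe_coe]
  field_simp

/-! ### The density as an integral over initial positions. -/

/-- The contribution of `y` to the density at `x`, up to the factor `t⁻²`. -/
noncomputable def kernel (f₀ : TH → ℝ) (t : ℝ) (p : Chart × Chart) : ℝ :=
  arc (coshDist p.2 p.1) / height p.2 * f₀ (p.2, t⁻¹ • logMap p.2 p.1)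

theorem contDiff_coshDist : ContDiff ℝ 1 fun p : Chart × Chart => coshDist p.2 p.1 :=
  ((contDiff_height.comp contDiff_snd).mul (contDiff_height.comp contDiff_fst)).sub
    (contDiff_snd.inner ℝ contDiff_fst)

theorem contDiff_arc_coshDist : ContDiff ℝ 1 fun p : Chart × Chart => arc (coshDist p.2 p.1) :=
  contDiff_iff_contDiffAt.2 fun p =>
    (contDiffOn_arc.contDiffAt (Ioi_mem_nhds (zero_lt_one.trans_le (one_le_coshDist _ _)))).comp
      (g := arc) p
      contDiff_coshDist.contDiffAt

theorem contDiff_kernel {f₀ : TH → ℝ} (hf : ContDiff ℝ 1 f₀) (t : ℝ) :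
    ContDiff ℝ 1 (kernel f₀ t) := by
  have h : ContDiff ℝ 1 fun p : Chart × Chart => logMap p.2 p.1 :=
    contDiff_arc_coshDist.smul (contDiff_fst.sub (contDiff_coshDist.smul contDiff_snd))
  exact (contDiff_arc_coshDist.div (contDiff_height.comp contDiff_snd)
    fun p => (height_pos _).ne').mul (hf.comp (contDiff_snd.prodMk (h.const_smul t⁻¹)))

theorem kernel_eq_zero {f₀ : TH → ℝ} {K : Set TH} (hK : tsupport f₀ ⊆ K) (t : ℝ) (x : Chart)
    {y : Chart} (hy : y ∉ Prod.fst '' K) : kernel f₀ t (x, y) = 0 := by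
  rw [kernel, image_eq_zero_of_notMem_tsupport fun h => hy ⟨_, hK h, rfl⟩, mul_zero]

theorem abs_det_smul_logMapDeriv (t : ℝ) (x y : Chart) :
    |((-t)⁻¹ • logMapDeriv x y).det| = (t ^ 2)⁻¹ * (arc (coshDist y x) * (height x / height y)) := by
  have h1 := arc_pos (one_le_coshDist x y)
  have h2 := height_pos x
  have h3 := height_pos y
  have : ((-t)⁻¹ • logMapDeriv x y).det = (t ^ 2)⁻¹ * (logMapDeriv x y).det := by
    rw [ContinuousLinearMap.det, ContinuousLinearMap.toLinearMap_smul, LinearMap.det_smul,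
      finrank_euclideanSpace_fin, inv_pow, neg_sq]
  rw [this, det_logMapDeriv, coshDist_comm y x, abs_of_nonneg (by positivity)]

/-- Change of variables from the velocity at time `t` to the initial position. -/
theorem IsVlasovField.integrable_and_density_eq {f₀ : TH → ℝ} (hf₀ : ContDiff ℝ 1 f₀) {K : Set TH}
    (hK : IsCompact K) (hfK : tsupport f₀ ⊆ K) {f : ℝ → TH → ℝ} (hf : IsVlasovField f₀ f) {t : ℝ}
    (ht : 0 < t) (x : Chart) : Integrable (fun v => f t (x, v)) ∧
      density f t x = (t ^ 2)⁻¹ * ∫ y in Prod.fst '' K, kernel f₀ t (x, y) := by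
  set V : Chart → Chart := fun y => (-t)⁻¹ • logMap x y
  have hV : ∀ y ∈ univ, HasFDerivWithinAt V ((-t)⁻¹ • logMapDeriv x y) univ y := fun y _ =>
    ((hasFDerivAt_logMap x y).const_smul (-t)⁻¹).hasFDerivWithinAt
  have hinj : InjOn V univ := fun y _ y' _ h =>
    logMap_injective x (smul_right_injective _ (inv_ne_zero (neg_ne_zero.2 ht.ne')) h)
  have himg : V '' univ = univ := image_univ_of_surjective (surjective_smul_logMap ht.ne' x)
  -- The factor `height x` of the Jacobian will cancel the volume density `√(det g) = 1 / height x`.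
  have hfV : ∀ y, |((-t)⁻¹ • logMapDeriv x y).det| • f t (x, V y) =
      (t ^ 2)⁻¹ * height x * kernel f₀ t (x, y) := fun y => by
    rw [hf.eq_flow ht.le, flow_neg_logMap ht.ne', abs_det_smul_logMapDeriv, kernel, smul_eq_mul]
    ring
  have hzero : ∀ y, y ∉ Prod.fst '' K → kernel f₀ t (x, y) = 0 := fun y => kernel_eq_zero hfK t x
  have hcont : Continuous fun y => kernel f₀ t (x, y) :=
    (contDiff_kernel hf₀ t).continuous.comp (by fun_prop)
  constructor
  · have h := integrableOn_image_iff_integrableOn_abs_det_fderiv_smul volume MeasurableSet.univ hV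
      hinj fun v => f t (x, v)
    rw [himg, integrableOn_univ, integrableOn_univ] at h
    rw [h]
    simp only [hfV]
    exact (hcont.integrable_of_hasCompactSupport
      (HasCompactSupport.intro (hK.image continuous_fst) hzero)).const_mul _
  · have h := integral_image_eq_integral_abs_det_fderiv_smul volume MeasurableSet.univ hV
      hinj fun v => f t (x, v)
    rw [himg, setIntegral_univ, setIntegral_univ] at h
    simp only [density, sqrt_det_gram]
    rw [integral_mul_const, h]
    simp only [hfV]
    rw [integral_const_mul, setIntegral_eq_integral_of_forall_compl_eq_zero hzero]
    have := (height_pos x).ne'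
    field_simp

/-! ### Growth of the differential of the inverse exponential map. -/

/-- The condition `‖h‖ ≤ height x` holds for every `g`-unit vector at `x` (`norm_le_of_metric_le`)
and is all that the estimates use. -/
theorem abs_coshDistDeriv_le {x y h : Chart} (hh : ‖h‖ ≤ height x) :
    |coshDistDeriv y x h| ≤ 4 * height y ^ 2 * coshDist y x := by
  have hx := height_pos x
  have hy := height_pos y
  have h1 : |⟪x, h⟫| ≤ height x * height x :=
    (abs_real_inner_le_norm x h).trans (mul_le_mul (norm_le_height x) hh (norm_nonneg _) hx.le)
  have h2 : |⟪y, h⟫| ≤ height y * height x :=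
    (abs_real_inner_le_norm y h).trans (mul_le_mul (norm_le_height y) hh (norm_nonneg _) hy.le)
  have h3 := height_le_coshDist y x
  calc |coshDistDeriv y x h| = |height y * (height x)⁻¹ * ⟪x, h⟫ - ⟪y, h⟫| := by
        simp [coshDistDeriv]
    _ ≤ |height y * (height x)⁻¹ * ⟪x, h⟫| + |⟪y, h⟫| := abs_sub _ _
    _ = height y * (height x)⁻¹ * |⟪x, h⟫| + |⟪y, h⟫| := by
        rw [abs_mul, abs_of_pos (mul_pos hy (inv_pos.2 hx))]
    _ ≤ height y * (height x)⁻¹ * (height x * height x) + height y * height x := by gcongr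
    _ = 2 * height y * height x := by field_simp; ring
    _ ≤ 2 * height y * (2 * height y * coshDist y x) := by gcongr
    _ = _ := by ring

/-- With `e = coshDist y x`, the `g`-length of `logMap y x` is `arc e * √(e² - 1)`, which dominates
`arc e * (e - 1)` and is at most the Euclidean norm; the remaining `arc e` is at most `2`. -/
theorem coshDist_mul_arc_le (x y : Chart) :
    coshDist y x * arc (coshDist y x) ≤ 2 + ‖logMap y x‖ := by
  have he := one_le_coshDist y x
  have ha := arc_pos he
  have h1 : (arc (coshDist y x) * (coshDist y x - 1)) ^ 2 ≤ ‖logMap y x‖ ^ 2 := by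
    have h2 := speedSq_eq (y, logMap y x)
    rw [speedSq_logMap] at h2
    have h3 : (coshDist y x - 1) ^ 2 ≤ coshDist y x ^ 2 - 1 := by nlinarith
    have h4 := mul_le_mul_of_nonneg_left h3 (sq_nonneg (arc (coshDist y x)))
    nlinarith [sq_nonneg (slope (y, logMap y x))]
  have h5 := abs_le_of_sq_le_sq' h1 (norm_nonneg _) |>.2
  linarith [arc_le he]

/-- Components of `x` and `h` may be of order `e`, exponential in the distance. They always meet
`arc` or `arcDeriv`, leaving only `e * arc e` and `|arcDeriv e| * e²`, which grow linearly. -/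
theorem norm_logMapDeriv_le {x y h : Chart} (hh : ‖h‖ ≤ height x) :
    ‖logMapDeriv y x h‖ ≤ height y ^ 3 * (72 + 18 * ‖logMap y x‖) := by
  have hM := one_le_height y
  have he := one_le_coshDist y x
  have ha := arc_pos he
  set M := height y
  set e := coshDist y x
  have hx : height x ≤ 2 * M * e := height_le_coshDist y x
  have hd : |coshDistDeriv y x h| ≤ 4 * M ^ 2 * e := abs_coshDistDeriv_le hh
  have hyM : ‖y‖ ≤ M := norm_le_height y
  have h1 : ‖logMapDeriv y x h‖ ≤ arc e * ‖h‖ + |coshDistDeriv y x h| *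
      (|arcDeriv e| * (‖x‖ + e * ‖y‖) + arc e * ‖y‖) := by
    have : logMapDeriv y x h = arc e • h + coshDistDeriv y x h •
      (arcDeriv e • (x - e • y) - arc e • y) := by
      simp [logMapDeriv, e]
    rw [this]
    have h2 : ‖x - e • y‖ ≤ ‖x‖ + e * ‖y‖ := (norm_sub_le _ _).trans_eq (by
      rw [norm_smul, norm_of_nonneg (zero_le_one.trans he)])
    calc _ ≤ ‖arc e • h‖ + ‖coshDistDeriv y x h • (arcDeriv e • (x - e • y) - arc e • y)‖ :=
          norm_add_le _ _
      _ = arc e * ‖h‖ + |coshDistDeriv y x h| * ‖arcDeriv e • (x - e • y) - arc e • y‖ := by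
          rw [norm_smul, norm_smul, norm_of_nonneg ha.le, norm_eq_abs]
      _ ≤ arc e * ‖h‖ + |coshDistDeriv y x h| * (‖arcDeriv e • (x - e • y)‖ + ‖arc e • y‖) := by
          gcongr; exact norm_sub_le _ _
      _ ≤ _ := by
          rw [norm_smul, norm_smul, norm_of_nonneg ha.le, norm_eq_abs]
          gcongr
  have h2 : ‖x‖ ≤ 2 * M * e := (norm_le_height x).trans hx
  have h3 : ‖h‖ ≤ 2 * M * e := hh.trans hx
  have h4 := abs_arcDeriv_mul_sq_le he
  have h5 : e * arc e ≤ 2 + ‖logMap y x‖ := coshDist_mul_arc_le x y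
  calc _ ≤ _ := h1
    _ ≤ arc e * (2 * M * e) + 4 * M ^ 2 * e *
        (|arcDeriv e| * (2 * M * e + e * M) + arc e * M) := by gcongr
    _ = 12 * M ^ 3 * (|arcDeriv e| * e ^ 2) + (2 * M + 4 * M ^ 3) * (e * arc e) := by ring
    _ ≤ 12 * M ^ 3 * (3 + e * arc e) + (2 * M ^ 3 + 4 * M ^ 3) * (e * arc e) := by
        gcongr
        exact le_self_pow₀ hM (by norm_num)
    _ = M ^ 3 * (36 + 18 * (e * arc e)) := by ring
    _ ≤ M ^ 3 * (36 + 18 * (2 + ‖logMap y x‖)) := by gcongr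
    _ = _ := by ring

/-! ### Pointwise bounds from the sup norm and the Sasaki gradient norm. -/

theorem supNorm_nonneg (f : TH → ℝ) : 0 ≤ supNorm f := Real.iSup_nonneg fun _ => abs_nonneg _

theorem gradNorm_nonneg (f : TH → ℝ) : 0 ≤ gradNorm f :=
  Real.sSup_nonneg fun _ ⟨_, _, _, _, ha⟩ => ha ▸ abs_nonneg _

theorem abs_le_supNorm {f : TH → ℝ} (hf : ContDiff ℝ 1 f) (hc : HasCompactSupport f) (z : TH) :
    |f z| ≤ supNorm f := by
  obtain ⟨C, hC⟩ := hf.continuous.bounded_above_of_compact_support hc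
  exact le_ciSup (f := fun z => |f z|) ⟨C, by rintro _ ⟨z, rfl⟩; exact hC z⟩ z

theorem metric_self_le (x v : Chart) : metric x v v ≤ ‖v‖ ^ 2 := by
  rw [metric_eq, real_inner_self_eq_norm_sq]
  have : 0 ≤ ⟪x, v⟫ * ⟪x, v⟫ / (1 + ‖x‖ ^ 2) := div_nonneg (mul_self_nonneg _) (by positivity)
  linarith

theorem abs_metric_le (x v w : Chart) : |metric x v w| ≤ 2 * (‖v‖ * ‖w‖) := by
  rw [metric_eq]
  refine (abs_sub _ _).trans ?_
  have h1 := abs_real_inner_le_norm v w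
  have h2 : |⟪x, v⟫ * ⟪x, w⟫ / (1 + ‖x‖ ^ 2)| ≤ ‖v‖ * ‖w‖ := by
    rw [abs_div, abs_mul, abs_of_pos (show 0 < 1 + ‖x‖ ^ 2 by positivity), div_le_iff₀ (by positivity)]
    calc _ ≤ (‖x‖ * ‖v‖) * (‖x‖ * ‖w‖) :=
          mul_le_mul (abs_real_inner_le_norm _ _) (abs_real_inner_le_norm _ _) (abs_nonneg _)
            (by positivity)
      _ ≤ _ := by nlinarith [mul_nonneg (norm_nonneg v) (norm_nonneg w)]
  linarith

theorem norm_le_of_metric_le {x v : Chart} (h : metric x v v ≤ 1) : ‖v‖ ≤ height x := by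
  have h1 := norm_sq_eq_speedSq_add (x, v)
  rw [← height_sq] at h1
  refine abs_le_of_sq_le_sq' ?_ (height_pos x).le |>.2
  exact h1.trans (mul_le_of_le_one_right (sq_nonneg _) h)

theorem exists_bound_of_isCompact {K : Set TH} (hK : IsCompact K) :
    ∃ M, 1 ≤ M ∧ ∀ z ∈ K, height z.1 ≤ M ∧ ‖z.2‖ ≤ M := by
  obtain ⟨C, hC⟩ := hK.exists_bound_of_continuousOn
    (f := fun z : TH => height z.1 + ‖z.2‖)
    ((contDiff_height (n := 0)).continuous.comp continuous_fst |>.add continuous_snd.norm).continuousOn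
  refine ⟨max C 1, le_max_right _ _, fun z hz => ?_⟩
  have h1 := (le_abs_self _).trans (hC z hz)
  have h2 := height_pos z.1
  have h3 := norm_nonneg z.2
  have h4 := le_max_left C 1
  constructor <;> linarith

theorem abs_fderiv_ver_le {f : TH → ℝ} (hf : ContDiff ℝ 1 f) (hc : HasCompactSupport f) (z : TH)
    (Z : Chart) : |fderiv ℝ f z (0, Z)| ≤ gradNorm f * ‖Z‖ := by
  obtain ⟨M, hM, hMK⟩ := exists_bound_of_isCompact hc
  obtain ⟨B, hB⟩ := (hf.continuous_fderiv one_ne_zero).bounded_above_of_compact_support (hc.fderiv ℝ)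
  have hB0 : 0 ≤ B := (norm_nonneg _).trans (hB z)
  -- Essential, since `sSup` of an unbounded set of reals is `0`; compact support supplies the
  -- bound.
  have hbdd : BddAbove {a | ∃ (z : TH) (Y Z : Chart), metric z.1 Y Y + metric z.1 Z Z ≤ 1 ∧
      a = |fderiv ℝ f z (hor z Y + ver Z)|} := by
    refine ⟨B * (2 * M * M * M + M), ?_⟩
    rintro _ ⟨z, Y, Z, hYZ, rfl⟩
    by_cases hz : z ∈ tsupport f
    · obtain ⟨h1, h2⟩ := hMK z hz
      have hY0 : 0 ≤ metric z.1 Y Y := speedSq_nonneg (z.1, Y)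
      have hZ0 : 0 ≤ metric z.1 Z Z := speedSq_nonneg (z.1, Z)
      have hY : ‖Y‖ ≤ M := (norm_le_of_metric_le (by linarith)).trans h1
      have hZ : ‖Z‖ ≤ M := (norm_le_of_metric_le (by linarith)).trans h1
      have hx : ‖z.1‖ ≤ M := (norm_le_height _).trans h1
      refine ((fderiv ℝ f z).le_opNorm _).trans (mul_le_mul (hB z) ?_ (norm_nonneg _) hB0)
      have hM3 : 0 ≤ 2 * M * M * M := by positivity
      rw [hor_eq, ver, Prod.mk_add_mk, add_zero, Prod.norm_mk]
      refine max_le (by linarith) ?_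
      calc ‖metric z.1 Y z.2 • z.1 + Z‖ ≤ |metric z.1 Y z.2| * ‖z.1‖ + ‖Z‖ :=
            (norm_add_le _ _).trans_eq (by rw [norm_smul, norm_eq_abs])
        _ ≤ 2 * (‖Y‖ * ‖z.2‖) * ‖z.1‖ + ‖Z‖ := by gcongr; exact abs_metric_le _ _ _
        _ ≤ 2 * (M * M) * M + M := by gcongr
        _ = _ := by ring
    · have : fderiv ℝ f z = 0 :=
        image_eq_zero_of_notMem_tsupport fun h => hz (tsupport_fderiv_subset ℝ h)
      simp only [this, zero_apply, abs_zero]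
      positivity
  rcases eq_or_ne Z 0 with rfl | hZ
  · rw [show ((0, 0) : TH) = 0 from rfl, map_zero]
    simp
  have hZ' : 0 < ‖Z‖ := norm_pos_iff.2 hZ
  -- A vertical vector of Euclidean norm one is admissible because `g` is at most the Euclidean
  -- metric.
  have h1 : |fderiv ℝ f z (hor z 0 + ver (‖Z‖⁻¹ • Z))| ≤ gradNorm f := by
    refine le_csSup hbdd ⟨z, 0, _, ?_, rfl⟩
    have h2 := metric_self_le z.1 (‖Z‖⁻¹ • Z)
    rw [norm_smul, norm_inv, norm_norm, inv_mul_cancel₀ hZ'.ne'] at h2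
    have h3 : metric z.1 0 0 = 0 := by simp [metric_eq]
    linarith
  have h2 : hor z 0 + ver (‖Z‖⁻¹ • Z) = ‖Z‖⁻¹ • ((0, Z) : TH) := by
    simp [hor_eq, ver, metric_eq]
  rw [h2, map_smul, smul_eq_mul, abs_mul, abs_of_pos (inv_pos.2 hZ'), inv_mul_le_iff₀ hZ'] at h1
  linarith

/-! ### Estimates for the kernel and the density. -/

/-- The base point `y` stays fixed as `x` moves, so only vertical derivatives of `f₀` occur. -/
theorem hasFDerivAt_kernel {f₀ : TH → ℝ} (hf : ContDiff ℝ 1 f₀) (t : ℝ) (x y : Chart) :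
    HasFDerivAt (fun x => kernel f₀ t (x, y))
      ((arc (coshDist y x) / height y) •
        (fderiv ℝ f₀ (y, t⁻¹ • logMap y x)).comp
          ((ContinuousLinearMap.inr ℝ Chart Chart).comp (t⁻¹ • logMapDeriv y x)) +
        f₀ (y, t⁻¹ • logMap y x) •
          ((height y)⁻¹ • arcDeriv (coshDist y x) • coshDistDeriv y x)) x := by
  have h1 : HasFDerivAt (fun x => arc (coshDist y x) / height y) _ x :=
    (hasFDerivAt_arc_coshDist y x).mul_const (height y)⁻¹
  have h2 : HasFDerivAt (fun x => t⁻¹ • logMap y x) (t⁻¹ • logMapDeriv y x) x :=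
    (hasFDerivAt_logMap y x).const_smul t⁻¹
  have h3 : HasFDerivAt f₀ (fderiv ℝ f₀ (y, t⁻¹ • logMap y x)) (y, t⁻¹ • logMap y x) :=
    (hf.differentiable one_ne_zero _).hasFDerivAt
  exact h1.mul (h3.comp x ((hasFDerivAt_prodMk_right y _).comp x h2))

theorem abs_fderiv_kernel_le {f₀ : TH → ℝ} (hf : ContDiff ℝ 1 f₀) {K : Set TH} (hK : IsCompact K)
    (hfK : tsupport f₀ ⊆ K) {M : ℝ} (hM : 1 ≤ M) (hMK : ∀ z ∈ K, height z.1 ≤ M ∧ ‖z.2‖ ≤ M)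
    {t : ℝ} (ht : 1 ≤ t) {x h : Chart} (hh : ‖h‖ ≤ height x) (y : Chart) :
    |fderiv ℝ (fun x => kernel f₀ t (x, y)) x h| ≤ 180 * M ^ 4 * sobolevNorm f₀ := by
  have hc : HasCompactSupport f₀ := hK.of_isClosed_subset (isClosed_tsupport f₀) hfK
  have hS := supNorm_nonneg f₀
  have hG := gradNorm_nonneg f₀
  have ht0 : 0 < t := zero_lt_one.trans_le ht
  rw [(hasFDerivAt_kernel hf t x y).fderiv]
  set z : TH := (y, t⁻¹ • logMap y x) with hz_def
  by_cases hz : z ∈ tsupport f₀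
  · obtain ⟨h1, h2⟩ := hMK z (hfK hz)
    have hy1 := one_le_height y
    have he := one_le_coshDist y x
    have ha := arc_pos he
    have hW : ‖logMap y x‖ ≤ t * M := by
      simp only [hz_def, norm_smul, norm_inv, norm_eq_abs, abs_of_pos ht0] at h2
      rwa [inv_mul_le_iff₀ ht0] at h2
    -- The initial velocity lies in the support, so `‖logMap y x‖ ≤ t * M`, and `t⁻¹` offsets the
    -- linear growth; `90 = 72 + 18`, using `1 ≤ t * M`.
    have hZ : ‖t⁻¹ • logMapDeriv y x h‖ ≤ 90 * M ^ 4 := by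
      rw [norm_smul, norm_inv, norm_eq_abs, abs_of_pos ht0, inv_mul_le_iff₀ ht0]
      calc _ ≤ height y ^ 3 * (72 + 18 * ‖logMap y x‖) := norm_logMapDeriv_le hh
        _ ≤ M ^ 3 * (72 + 18 * (t * M)) := by gcongr
        _ ≤ M ^ 3 * (72 * (t * M) + 18 * (t * M)) := by
            gcongr
            nlinarith
        _ = _ := by ring
    have hA : |arc (coshDist y x) / height y| ≤ 2 := by
      rw [abs_of_nonneg (by positivity)]
      exact (div_le_self ha.le hy1).trans (arc_le he)
    have hB : |(height y)⁻¹ * (arcDeriv (coshDist y x) * coshDistDeriv y x h)| ≤ 8 * M ^ 2 := by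
      rw [abs_mul, abs_mul, abs_of_pos (inv_pos.2 (height_pos y))]
      calc _ ≤ 1 * (|arcDeriv (coshDist y x)| * (4 * height y ^ 2 * coshDist y x)) := by
            gcongr
            · exact inv_le_one_of_one_le₀ hy1
            · exact abs_coshDistDeriv_le hh
        _ = 4 * height y ^ 2 * (|arcDeriv (coshDist y x)| * coshDist y x) := by ring
        _ ≤ 4 * M ^ 2 * 2 := by
            gcongr
            exact abs_arcDeriv_mul_le he
        _ = _ := by ring
    simp only [add_apply, smul_apply, ContinuousLinearMap.comp_apply, smul_eq_mul,
      ContinuousLinearMap.inr_apply]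
    refine (abs_add_le _ _).trans ?_
    rw [abs_mul, abs_mul]
    calc _ ≤ 2 * (gradNorm f₀ * (90 * M ^ 4)) + supNorm f₀ * (8 * M ^ 2) := by
          gcongr
          · exact (abs_fderiv_ver_le hf hc _ _).trans (by gcongr)
          · exact abs_le_supNorm hf hc _
      _ ≤ 180 * M ^ 4 * gradNorm f₀ + 180 * M ^ 4 * supNorm f₀ := by
          have : 8 * M ^ 2 ≤ 180 * M ^ 4 := by
            have := pow_le_pow_right₀ hM (show 2 ≤ 4 by norm_num)
            have : 0 ≤ M ^ 4 := by positivity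
            linarith
          nlinarith
      _ = _ := by rw [sobolevNorm]; ring
  · have h0 : fderiv ℝ f₀ z = 0 :=
      image_eq_zero_of_notMem_tsupport fun h => hz (tsupport_fderiv_subset ℝ h)
    rw [h0, image_eq_zero_of_notMem_tsupport hz]
    simp only [ContinuousLinearMap.zero_comp, smul_zero, zero_smul, add_zero,
      zero_apply, abs_zero, sobolevNorm]
    positivity

theorem abs_kernel_le {f₀ : TH → ℝ} (hf : ContDiff ℝ 1 f₀) (hc : HasCompactSupport f₀) (t : ℝ)
    (p : Chart × Chart) : |kernel f₀ t p| ≤ 2 * supNorm f₀ := by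
  have he := one_le_coshDist p.2 p.1
  have ha := arc_pos he
  have hp := height_pos p.2
  rw [kernel, abs_mul, abs_of_nonneg (by positivity)]
  gcongr
  · exact (div_le_self ha.le (one_le_height _)).trans (arc_le he)
  · exact abs_le_supNorm hf hc _

/-- The total estimate for the density and its differential. -/
theorem IsVlasovField.density_estimates {f₀ : TH → ℝ} (hf₀ : ContDiff ℝ 1 f₀) {K : Set TH}
    (hK : IsCompact K) (hfK : tsupport f₀ ⊆ K) {M : ℝ} (hM : 1 ≤ M)
    (hMK : ∀ z ∈ K, height z.1 ≤ M ∧ ‖z.2‖ ≤ M) {f : ℝ → TH → ℝ} (hf : IsVlasovField f₀ f) {t : ℝ}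
    (ht : 1 ≤ t) (x : Chart) :
    |density f t x| ≤
      (t ^ 2)⁻¹ * (2 * supNorm f₀ * volume.real (Prod.fst '' K : Set Chart)) ∧
    DifferentiableAt ℝ (density f t) x ∧ ∀ h : Chart, ‖h‖ ≤ height x →
      |fderiv ℝ (density f t) x h| ≤ (t ^ 2)⁻¹ *
        (180 * M ^ 4 * sobolevNorm f₀ * volume.real (Prod.fst '' K : Set Chart)) := by
  have ht0 : 0 < t := zero_lt_one.trans_le ht
  have hc : HasCompactSupport f₀ := hK.of_isClosed_subset (isClosed_tsupport f₀) hfK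
  have hK1 : IsCompact (Prod.fst '' K : Set Chart) := hK.image continuous_fst
  have hρ : density f t = fun x => (t ^ 2)⁻¹ * ∫ y in Prod.fst '' K, kernel f₀ t (x, y) :=
    funext fun x => (hf.integrable_and_density_eq hf₀ hK hfK ht0 x).2
  have hk := contDiff_kernel hf₀ t
  obtain ⟨hd, hi⟩ := hasFDerivAt_setIntegral_of_contDiffOn (μ := volume) isOpen_univ
    (hk.contDiffOn (s := univ)) hK1 isOpen_univ (subset_univ _) (mem_univ x)
  have hd' : HasFDerivAt (density f t) _ x := hρ ▸ hd.const_mul (t ^ 2)⁻¹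
  refine ⟨?_, hd'.differentiableAt, fun h hh => ?_⟩
  · rw [hρ, abs_mul, abs_of_pos (by positivity)]
    gcongr
    rw [← norm_eq_abs]
    exact norm_setIntegral_le_of_norm_le_const hK1.measure_lt_top fun y _ =>
      abs_kernel_le hf₀ hc t (x, y)
  · rw [hd'.fderiv, smul_apply, smul_eq_mul, abs_mul, abs_of_pos (by positivity),
      ContinuousLinearMap.integral_apply hi]
    gcongr
    rw [← norm_eq_abs]
    refine norm_setIntegral_le_of_norm_le_const hK1.measure_lt_top fun y _ => ?_
    have h1 : HasFDerivAt (fun x => kernel f₀ t (x, y))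
        ((fderiv ℝ (kernel f₀ t) (x, y)).comp (ContinuousLinearMap.inl ℝ Chart Chart)) x :=
      (hk.differentiable one_ne_zero (x, y)).hasFDerivAt.comp (f := fun x => (x, y)) x
        (hasFDerivAt_prodMk_left x y)
    rw [← h1.fderiv]
    exact abs_fderiv_kernel_le hf₀ hK hfK hM hMK ht hh y

/-! ### Polar coordinates and conclusion. -/

theorem height_polar (r θ : ℝ) : height (polar r θ) = cosh r := congrArg Prod.fst (embed_polar r θ)

theorem polar_eq (r θ : ℝ) :
    polar r θ = sinh r • (cos θ • basisVec 0 + sin θ • basisVec 1) := by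
  ext i
  fin_cases i <;> simp [polar, basisVec]

theorem norm_smul_basisVec_add (a b : ℝ) (h : a ^ 2 + b ^ 2 = 1) :
    ‖a • basisVec 0 + b • basisVec 1‖ = 1 := by
  rw [← sq_eq_sq₀ (norm_nonneg _) zero_le_one, EuclideanSpace.norm_sq_eq, Fin.sum_univ_two]
  simp [basisVec, h]

theorem hasDerivAt_polar_radius (r θ : ℝ) : HasDerivAt (fun s => polar s θ)
    (cosh r • (cos θ • basisVec 0 + sin θ • basisVec 1)) r := by
  simp only [polar_eq]
  exact (hasDerivAt_sinh r).smul_const _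

theorem hasDerivAt_polar_angle (r θ : ℝ) : HasDerivAt (fun φ => polar r φ)
    (sinh r • ((-sin θ) • basisVec 0 + cos θ • basisVec 1)) θ := by
  simp only [polar_eq]
  exact (((hasDerivAt_cos θ).smul_const _).add ((hasDerivAt_sin θ).smul_const _)).const_smul (sinh r)

end H2

end

theorem mainTheorem2 (K : Set H2.TH) (hK : IsCompact K) :
    ∃ C : ℝ, 0 < C ∧ ∀ f₀ : H2.TH → ℝ, ContDiff ℝ 1 f₀ → tsupport f₀ ⊆ K →
      (∃ f : ℝ → H2.TH → ℝ, H2.IsVlasovField f₀ f) ∧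
      ∀ f : ℝ → H2.TH → ℝ, H2.IsVlasovField f₀ f → ∀ t : ℝ, 1 ≤ t →
        (∀ x : H2.Chart, MeasureTheory.Integrable (fun v : H2.Chart => f t (x, v)) ∧
          |H2.density f t x| ≤ C * (1 / t ^ 2) * H2.supNorm f₀) ∧
        Differentiable ℝ (H2.density f t) ∧
        (∀ r θ : ℝ, 0 < r →
          |(1 / Real.sinh r) * deriv (fun φ => H2.density f t (H2.polar r φ)) θ|
            ≤ C * (1 / t) * H2.sobolevNorm f₀) ∧
        (∀ r θ : ℝ, 0 ≤ r →
          |deriv (fun s => H2.density f t (H2.polar s θ)) r|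
            ≤ C * (1 / t) * H2.sobolevNorm f₀) := by
  obtain ⟨M, hM, hMK⟩ := H2.exists_bound_of_isCompact hK
  set m := MeasureTheory.volume.real (Prod.fst '' K : Set H2.Chart)
  have hm : 0 ≤ m := MeasureTheory.measureReal_nonneg
  have hM4 : 1 ≤ M ^ 4 := one_le_pow₀ hM
  -- The summand `1` keeps the constant positive when the projection of `K` is a null set.
  refine ⟨180 * M ^ 4 * m + 1, by positivity, fun f₀ hf₀ hfK =>
    ⟨⟨_, H2.isVlasovField_flow hf₀⟩, fun f hf t ht => ?_⟩⟩
  have ht0 : 0 < t := zero_lt_one.trans_le ht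
  have key := fun x => hf.density_estimates hf₀ hK hfK hM hMK ht x
  have hS := H2.supNorm_nonneg f₀
  have hW : 0 ≤ H2.sobolevNorm f₀ := add_nonneg hS (H2.gradNorm_nonneg f₀)
  have hgrad : ∀ x h : H2.Chart, ‖h‖ ≤ H2.height x → |fderiv ℝ (H2.density f t) x h| ≤
      (180 * M ^ 4 * m + 1) * (1 / t) * H2.sobolevNorm f₀ := fun x h hh => by
    refine ((key x).2.2 h hh).trans ?_
    -- The derivative bound available here has the stronger rate `t⁻²`.
    have h1 : (t ^ 2)⁻¹ ≤ 1 / t := by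
      rw [one_div]
      exact inv_anti₀ ht0 (le_self_pow₀ ht two_ne_zero)
    calc _ ≤ (1 / t) * (180 * M ^ 4 * H2.sobolevNorm f₀ * m) := by gcongr
      _ = 180 * M ^ 4 * m * (1 / t) * H2.sobolevNorm f₀ := by ring
      _ ≤ _ := by gcongr; linarith
  refine ⟨fun x => ⟨(hf.integrable_and_density_eq hf₀ hK hfK ht0 x).1, ?_⟩,
    fun x => (key x).2.1, fun r θ hr => ?_, fun r θ _ => ?_⟩
  · refine (key x).1.trans ?_
    calc _ = 2 * m * (1 / t ^ 2) * H2.supNorm f₀ := by ring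
      _ ≤ _ := by gcongr; nlinarith
  · have hs := Real.sinh_pos_iff.2 hr
    have h : HasDerivAt (fun φ => H2.density f t (H2.polar r φ)) _ θ :=
      (key _).2.1.hasFDerivAt.comp_hasDerivAt θ (H2.hasDerivAt_polar_angle r θ)
    rw [h.deriv, map_smul, smul_eq_mul, ← mul_assoc, one_div_mul_cancel hs.ne', one_mul]
    refine hgrad _ _ ?_
    rw [H2.norm_smul_basisVec_add _ _ (by rw [neg_sq, Real.sin_sq_add_cos_sq])]
    exact H2.one_le_height _
  · have h : HasDerivAt (fun s => H2.density f t (H2.polar s θ)) _ r :=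
      (key _).2.1.hasFDerivAt.comp_hasDerivAt r (H2.hasDerivAt_polar_radius r θ)
    rw [h.deriv]
    -- The radial unit vector has Euclidean norm exactly `cosh r = height`, the extreme admissible
    -- case; nothing degenerates at `r = 0`.
    refine hgrad _ _ ?_
    rw [norm_smul, H2.norm_smul_basisVec_add _ _ (Real.cos_sq_add_sin_sq θ), mul_one, H2.height_polar,
      Real.norm_of_nonneg (Real.cosh_pos r).le]
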